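/- Let $n\in\mathbb N$, $\ell\in\{1,\dots,n\}$, and let $(K_\alpha)_{\alpha\in\mathbb N_0^n}$ be a family of real constants. There is a constant $C>0$, depending only on $n$, $\ell$ and the family $(K_\alpha)$, such that the following holds. Let $\Omega\subset\mathbb R^n$ be a bounded domain that is star shaped with respect to a ball $B\subset\Omega$, i.e. for every $y\in\Omega$ the convex hull of $B\cup\{y\}$ is contained in $\Omega$. Set $R=\operatorname{diam}(\Omega)$ and $\rho=\operatorname{diam}(B)$. Let $\theta\in C^\infty(\mathbb R^n)$ be supported in $\overline B$ with $\int\theta\,dx=1$ and, for every multi-index $\alpha$, $$\|\partial^\alpha\theta\|_{L^1}\le \frac{K_\alpha}{\rho^{|\alpha|}},\qquad \|\partial^\alpha\theta\|_{L^\infty}\le \frac{K_\alpha}{\rho^{n+|\alpha|}} .$$ For $m\in\{1,\dots,n\}$ and a real-valued $f\in L^2(\mathbb R^n)$ with $\operatorname{supp} f\subset\overline\Omega$, let $$Q_\ell f(x)=\int_0^1(1-s)^{n-\ell}\int_{\mathbb R^n}\theta\Big(y+\frac{x-y}{s}\Big)\,\frac{x_m-y_m}{s}\,f(y)\,dy\,\frac{ds}{s^n}.$$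 Then for almost every $x\in\Omega$ this double integral converges absolutely, $Q_\ell f\in H^1(\Omega)$, and its $H^1$-seminorm $|u|_{H^1(\Omega)}=\big(\sum_{j=1}^n\|\partial_j u\|_{L^2(\Omega)}^2\big)^{1/2}$ satisfies $$|Q_\ell f|_{H^1(\Omega)}\le C\,\frac R\rho\,\kappa\,\|f\|_{L^2(\Omega)},$$ where $\kappa=1$ if $\ell<\frac n2+1$, and, if $\ell\ge\frac n2+1$, $$\kappa=1+\Big(\log\frac{|\Omega|}{|B|}\Big)^{\frac{n}{2(\ell-1)}}\Big(\frac{|\Omega|}{|B|}\Big)^{\frac{2(\ell-1)-n}{2(\ell-1)}} .$$ -/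

import Mathlib

open MeasureTheory Set
open scoped ContDiff

noncomputable section

/-- The partial derivative `∂_j u`. -/
def partialDeriv {n : ℕ} (j : Fin n) (u : EuclideanSpace ℝ (Fin n) → ℝ) :
    EuclideanSpace ℝ (Fin n) → ℝ :=
  fun x => fderiv ℝ u x (EuclideanSpace.single j 1)

/-- The derivative `∂^α u = ∂_1^{α_1} ⋯ ∂_n^{α_n} u` for a multi-index `α`. -/
def multiDeriv {n : ℕ} (α : Fin n → ℕ) (u : EuclideanSpace ℝ (Fin n) → ℝ) :
    EuclideanSpace ℝ (Fin n) → ℝ :=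
  (List.finRange n).foldr (fun j v => (partialDeriv j)^[α j] v) u

/-- `Ω` is a bounded domain that is star shaped with respect to the ball `B = ball c r ⊆ Ω`:
for every `y ∈ Ω` the convex hull of `B ∪ {y}` is contained in `Ω`.
(Connectedness is then automatic.) -/
structure IsBoundedDomainStarShapedBall {n : ℕ} (Ω : Set (EuclideanSpace ℝ (Fin n)))
    (c : EuclideanSpace ℝ (Fin n)) (r : ℝ) : Prop where
  isOpen : IsOpen Ω
  isBounded : Bornology.IsBounded Ω
  radius_pos : 0 < r
  ball_subset : Metric.ball c r ⊆ Ω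
  convexHull_subset : ∀ y ∈ Ω, convexHull ℝ (Metric.ball c r ∪ {y}) ⊆ Ω

/-- `θ` is a smooth function of integral one, supported on the ball with centre `c` and radius `r`,
whose derivatives satisfy `‖∂^α θ‖_{L^1} ≤ K α / diam(B)^{|α|}` and
`‖∂^α θ‖_{L^∞} ≤ K α / diam(B)^{n + |α|}`. -/
structure IsRegularizingKernel {n : ℕ} (K : (Fin n → ℕ) → ℝ)
    (c : EuclideanSpace ℝ (Fin n)) (r : ℝ) (θ : EuclideanSpace ℝ (Fin n) → ℝ) : Prop where
  contDiff : ContDiff ℝ ∞ θ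
  tsupport_subset : tsupport θ ⊆ Metric.closedBall c r
  integral_eq_one : ∫ x, θ x = 1
  integral_abs_le : ∀ α : Fin n → ℕ,
    ∫ x, |multiDeriv α θ x| ≤ K α / Metric.diam (Metric.ball c r) ^ (∑ i, α i)
  abs_le : ∀ (α : Fin n → ℕ) (x : EuclideanSpace ℝ (Fin n)),
    |multiDeriv α θ x| ≤ K α / Metric.diam (Metric.ball c r) ^ (n + ∑ i, α i)

/-- The integrand of `Q_ℓ f(x)`, as a function of `s` and `y`. -/
def bogIntegrand {n : ℕ} (ℓ : ℕ) (θ : EuclideanSpace ℝ (Fin n) → ℝ) (m : Fin n)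
    (f : EuclideanSpace ℝ (Fin n) → ℝ) (x : EuclideanSpace ℝ (Fin n))
    (s : ℝ) (y : EuclideanSpace ℝ (Fin n)) : ℝ :=
  (1 - s) ^ (n - ℓ) * (θ (y + s⁻¹ • (x - y)) * ((x m - y m) / s) * f y) / s ^ n

/-- The reduced Bogovskiĭ-type operator
`Q_ℓ f(x) = ∫_0^1 (1-s)^{n-ℓ} ∫ θ(y + (x-y)/s) ((x_m - y_m)/s) f(y) dy ds / s^n`. -/
def bogReduced {n : ℕ} (ℓ : ℕ) (θ : EuclideanSpace ℝ (Fin n) → ℝ) (m : Fin n)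
    (f : EuclideanSpace ℝ (Fin n) → ℝ) (x : EuclideanSpace ℝ (Fin n)) : ℝ :=
  ∫ s in Ioo (0 : ℝ) 1, ∫ y, bogIntegrand ℓ θ m f x s y

/-- `u ∈ H^1(Ω)`, with weak gradient `g = (g_1, …, g_n)`: `u` and all `g_j` are in `L^2(Ω)` and
`∫_Ω u ∂_j φ = - ∫_Ω g_j φ` for every `φ ∈ C_c^∞(Ω)`. -/
structure HasL2WeakGradient {n : ℕ} (Ω : Set (EuclideanSpace ℝ (Fin n)))
    (u : EuclideanSpace ℝ (Fin n) → ℝ) (g : Fin n → EuclideanSpace ℝ (Fin n) → ℝ) : Prop where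
  memLp : MemLp u 2 (volume.restrict Ω)
  memLp_grad : ∀ j, MemLp (g j) 2 (volume.restrict Ω)
  integral_eq : ∀ (j : Fin n) (φ : EuclideanSpace ℝ (Fin n) → ℝ),
    ContDiff ℝ ∞ φ → HasCompactSupport φ → tsupport φ ⊆ Ω →
      ∫ x in Ω, u x * partialDeriv j φ x = - ∫ x in Ω, g j x * φ x

/-- The factor `κ`, a function of `n`, `ℓ` and the volume ratio `t = |Ω| / |B|`. -/
def bogKappa (n ℓ : ℕ) (t : ℝ) : ℝ :=
  if (ℓ : ℝ) < (n : ℝ) / 2 + 1 then 1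
  else 1 + Real.log t ^ ((n : ℝ) / (2 * ((ℓ : ℝ) - 1))) *
    t ^ ((2 * ((ℓ : ℝ) - 1) - (n : ℝ)) / (2 * ((ℓ : ℝ) - 1)))

end

/-!
Pair `Q_ℓ f` with a derivative `∂_j φ` of a test function. The substitution `x = (1 - s) y + s z`
and the splitting `(x_m - y_m) / s = (z_m - c_m) - (y_m - c_m)` turn the pairing into two integrals
`∫₀¹ (1 - s)^(n - ℓ) ∬ h(y) η(z) ∂_j φ((1 - s) y + s z) dy dz ds`, where `η` is a bump function at
scale `ρ` and `h` is supported in `Ω`. By Fourier inversion the slice at `s` equals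
`∫ ĥ((1 - s) ξ) η̂(s ξ) (∂_j φ)^(ξ) dξ`.

For `s < 1/2` the dilation of `ĥ` is harmless. The derivative costs a factor `|ξ|`, which is
recovered by integrating the decay `|η̂(s ξ)| ≲ (1 + (ρ s |ξ|)²)⁻¹` in `s`; this yields `1 / ρ`.

For `s ≥ 1/2` the decay of `η̂` absorbs the derivative slice by slice. The dilation costs
`(1 - s)^(-n/2)`, while `‖ĥ‖_∞ ≤ ‖h‖₁ ≤ |Ω|^(1/2) ‖h‖₂` bounds the same slice by `t^(1/2)` with
`t = |Ω| / |B|`. Integrating `(1 - s)^(n - ℓ)` against the smaller of the two, with crossover at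
`1 - s = t^(-1/n)`, gives a multiple of `κ`.

These bounds make `φ ↦ ∫ Q_ℓ f ∂_j φ` bounded in `L²`, and the Riesz representation theorem provides
the weak derivative.
-/

open scoped FourierTransform SchwartzMap ENNReal LineDeriv

section Fourier

variable {V : Type*} [NormedAddCommGroup V] [InnerProductSpace ℝ V] [FiniteDimensional ℝ V]
  [MeasurableSpace V] [BorelSpace V]

theorem integral_mul_fourierInv_smul (t : ℝ) {h G : V → ℂ} (hh : Integrable h)
    (hG : Integrable G) :
    ∫ y, h y * 𝓕⁻ G (t • y) = ∫ ξ, 𝓕⁻ h (t • ξ) * G ξ := by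
  have self_adjoint := VectorFourier.integral_fourierIntegral_smul_eq_flip
    (e := Real.fourierChar) (μ := (volume : Measure V)) (ν := (volume : Measure V))
    (L := (-t) • innerₗ V) (f := h) (g := G) Real.continuous_fourierChar
    (by simp only [LinearMap.smul_apply, innerₗ_apply_apply, smul_eq_mul]; fun_prop) hh hG
  have fourierIntegral_eq : ∀ ξ, VectorFourier.fourierIntegral Real.fourierChar volume
      ((-t) • innerₗ V) h ξ = 𝓕⁻ h (t • ξ) := fun ξ => by
    rw [Real.fourierInv_eq]
    simp [VectorFourier.fourierIntegral, inner_smul_right]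
  have fourierIntegral_flip_eq : ∀ y, VectorFourier.fourierIntegral Real.fourierChar volume
      ((-t) • innerₗ V).flip G y = 𝓕⁻ G (t • y) := fun y => by
    rw [Real.fourierInv_eq]
    simp [VectorFourier.fourierIntegral, inner_smul_right, real_inner_comm]
  simp only [fourierIntegral_eq, fourierIntegral_flip_eq, smul_eq_mul] at self_adjoint
  exact self_adjoint.symm

theorem continuous_fourierInv {h : V → ℂ} (hh : Integrable h) : Continuous (𝓕⁻ h) := by
  have fourierInv_eq : 𝓕⁻ h = fun x => 𝓕 h (-x) := by
    ext x
    exact Real.fourierInv_eq_fourier_neg h x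
  rw [fourierInv_eq]
  exact (VectorFourier.fourierIntegral_continuous Real.continuous_fourierChar
    (by exact continuous_inner) hh).comp continuous_neg

theorem norm_fourierInv_le_integral_norm (h : V → ℂ) (ξ : V) : ‖𝓕⁻ h ξ‖ ≤ ∫ x, ‖h x‖ := by
  rw [Real.fourierInv_eq]
  exact (norm_integral_le_integral_norm _).trans_eq (by simp only [Circle.norm_smul])

theorem schwartz_apply_add_eq_fourierInv (ψ : 𝓢(V, ℂ)) (a b : V) :
    ψ (a + b) = 𝓕⁻ (fun ξ => (Real.fourierChar (inner ℝ ξ a) : ℂ) * 𝓕 ψ ξ) b := by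
  conv_lhs => rw [← FourierTransform.fourierInv_fourier_eq (F := 𝓢(V, ℂ)) ψ]
  rw [SchwartzMap.fourierInv_coe, Real.fourierInv_eq, Real.fourierInv_eq]
  congr 1 with ξ
  rw [inner_add_right, add_comm, AddChar.map_add_eq_mul, mul_smul]
  rfl

theorem integrable_fourierChar_mul_fourier (ψ : 𝓢(V, ℂ)) (a : V) :
    Integrable fun ξ => (Real.fourierChar (inner ℝ ξ a) : ℂ) * 𝓕 ψ ξ := by
  have continuous_char : Continuous fun ξ : V => (Real.fourierChar (inner ℝ ξ a) : ℂ) :=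
    continuous_subtype_val.comp (Real.continuous_fourierChar.comp (by fun_prop))
  exact (𝓕 ψ).integrable.bdd_mul (c := 1) continuous_char.aestronglyMeasurable
    (.of_forall fun ξ => (Circle.norm_coe _).le)

theorem integral_mul_integral_mul_comp_add_smul (s t : ℝ) {h η : V → ℂ} (hh : Integrable h)
    (hη : Integrable η) (ψ : 𝓢(V, ℂ)) :
    ∫ y, h y * ∫ z, η z * ψ (t • y + s • z) =
      ∫ ξ, 𝓕⁻ h (t • ξ) * (𝓕⁻ η (s • ξ) * 𝓕 ψ ξ) := by
  have integrable_product : Integrable fun ξ => 𝓕⁻ η (s • ξ) * 𝓕 ψ ξ :=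
    (𝓕 ψ).integrable.bdd_mul (c := ∫ x, ‖η x‖)
      ((continuous_fourierInv hη).comp (continuous_const_smul s)).aestronglyMeasurable
      (.of_forall fun ξ => norm_fourierInv_le_integral_norm _ _)
  rw [← integral_mul_fourierInv_smul t hh integrable_product]
  congr 1 with y
  congr 1
  simp only [schwartz_apply_add_eq_fourierInv]
  rw [integral_mul_fourierInv_smul s hη (integrable_fourierChar_mul_fourier ψ _),
    Real.fourierInv_eq]
  congr 1 with ξ
  simp only [Circle.smul_def, smul_eq_mul]
  ring

theorem coeFn_fourierInv_toLp_ae_eq {h : V → ℂ} (hh : Integrable h) (h2 : MemLp h 2 volume) :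
    (𝓕⁻ (h2.toLp h) : Lp ℂ 2 (volume : Measure V)) =ᵐ[volume] 𝓕⁻ h := by
  set F : Lp ℂ 2 (volume : Measure V) := h2.toLp h
  refine ae_eq_of_integral_contDiff_smul_eq ((Lp.memLp _).locallyIntegrable (by norm_num))
    (continuous_fourierInv hh).locallyIntegrable fun g hg hgc => ?_
  have hasCompactSupport_ofReal : HasCompactSupport (Complex.ofRealCLM ∘ g) := hgc.comp_left rfl
  set G : 𝓢(V, ℂ) := hasCompactSupport_ofReal.toSchwartzMap (by fun_prop)
  have G_apply : ∀ x, G x = (g x : ℂ) := fun x => rfl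
  have distributional := congrArg (fun T => T G) (Lp.fourierInv_toTemperedDistribution_eq F)
  simp only [TemperedDistribution.fourierInv_apply, Lp.toTemperedDistribution_apply,
    smul_eq_mul] at distributional
  have pointwise := integral_mul_fourierInv_smul 1 hh G.integrable
  simp only [one_smul] at pointwise
  simp only [Complex.real_smul]
  calc ∫ x, g x * (𝓕⁻ F : Lp ℂ 2 (volume : Measure V)) x
      = ∫ x, G x * (𝓕⁻ F : Lp ℂ 2 (volume : Measure V)) x := by simp only [G_apply]
    _ = ∫ x, (𝓕⁻ G) x * F x := distributional.symm
    _ = ∫ x, h x * 𝓕⁻ (⇑G) x := by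
      refine integral_congr_ae ?_
      filter_upwards [h2.coeFn_toLp] with x hx
      rw [hx, mul_comm, SchwartzMap.fourierInv_coe]
    _ = ∫ x, 𝓕⁻ h x * G x := pointwise
    _ = ∫ x, g x * 𝓕⁻ h x := by simp only [G_apply, mul_comm]

theorem eLpNorm_fourierInv_eq {h : V → ℂ} (hh : Integrable h) (h2 : MemLp h 2 volume) :
    eLpNorm (𝓕⁻ h) 2 volume = eLpNorm h 2 volume := by
  rw [← eLpNorm_congr_ae (coeFn_fourierInv_toLp_ae_eq hh h2), ← eLpNorm_congr_ae h2.coeFn_toLp,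
    ← Lp.enorm_def, ← Lp.enorm_def, ← ofReal_norm, ← ofReal_norm]
  exact congrArg ENNReal.ofReal ((Lp.fourierTransformₗᵢ V ℂ).symm.norm_map (h2.toLp h))

theorem norm_fourier_lineDeriv (ψ : 𝓢(V, ℂ)) (v ξ : V) :
    ‖𝓕 (∂_{v} ψ) ξ‖ = 2 * Real.pi * |inner ℝ ξ v| * ‖𝓕 ψ ξ‖ := by
  have : (inner ℝ · v).HasTemperateGrowth := ((innerSL ℝ).flip v).hasTemperateGrowth
  rw [SchwartzMap.fourier_lineDerivOp_eq]
  simp [this, abs_of_pos Real.pi_pos, mul_assoc]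

theorem norm_fourierInv_lineDeriv (ψ : 𝓢(V, ℂ)) (v ξ : V) :
    ‖𝓕⁻ (∂_{v} ψ) ξ‖ = 2 * Real.pi * |inner ℝ ξ v| * ‖𝓕⁻ ψ ξ‖ := by
  have : (inner ℝ · v).HasTemperateGrowth := ((innerSL ℝ).flip v).hasTemperateGrowth
  rw [SchwartzMap.fourierInv_lineDerivOp_eq]
  simp [this, abs_of_pos Real.pi_pos, mul_assoc]

end Fourier

section Inequalities

variable {α β : Type*} [MeasurableSpace α] [MeasurableSpace β] {μ : Measure α} {ν : Measure β}

theorem lintegral_mul_sq_le {f g : α → ℝ≥0∞} (hf : AEMeasurable f μ) (hg : AEMeasurable g μ) :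
    (∫⁻ a, f a * g a ∂μ) ^ 2 ≤ (∫⁻ a, f a ^ 2 ∂μ) * ∫⁻ a, g a ^ 2 ∂μ := by
  have holder := ENNReal.lintegral_mul_le_Lp_mul_Lq μ Real.HolderConjugate.two_two hf hg
  simp only [Pi.mul_apply, ENNReal.rpow_two] at holder
  calc (∫⁻ a, f a * g a ∂μ) ^ 2
      ≤ ((∫⁻ a, f a ^ 2 ∂μ) ^ (1 / 2 : ℝ) * (∫⁻ a, g a ^ 2 ∂μ) ^ (1 / 2 : ℝ)) ^ 2 := by gcongr
    _ = (∫⁻ a, f a ^ 2 ∂μ) * ∫⁻ a, g a ^ 2 ∂μ := by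
      rw [← ENNReal.mul_rpow_of_nonneg _ _ (by norm_num), ← ENNReal.rpow_natCast,
        ← ENNReal.rpow_mul]
      norm_num

theorem lintegral_weight_mul_sq_le {w f g : α → ℝ≥0∞} (hw : AEMeasurable w μ)
    (hf : AEMeasurable f μ) (hg : AEMeasurable g μ) :
    (∫⁻ a, w a * f a * g a ∂μ) ^ 2 ≤ (∫⁻ a, w a * f a ^ 2 ∂μ) * ∫⁻ a, w a * g a ^ 2 ∂μ := by
  have sqrt_mul_sqrt : ∀ x : ℝ≥0∞, x ^ (1 / 2 : ℝ) * x ^ (1 / 2 : ℝ) = x := fun x => by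
    rw [← ENNReal.rpow_add_of_nonneg _ _ (by norm_num) (by norm_num)]
    norm_num
  have cauchy_schwarz := lintegral_mul_sq_le (μ := μ) (f := fun a => w a ^ (1 / 2 : ℝ) * f a)
    (g := fun a => w a ^ (1 / 2 : ℝ) * g a) (by fun_prop) (by fun_prop)
  simp only [mul_pow, pow_two (_ ^ (1 / 2 : ℝ)), sqrt_mul_sqrt] at cauchy_schwarz
  refine le_trans (le_of_eq ?_) cauchy_schwarz
  congr 2 with a
  rw [mul_mul_mul_comm, sqrt_mul_sqrt, mul_assoc]

theorem lintegral_lintegral_mul_sq_le_of_schur [SFinite μ] [SFinite ν] {k : α → β → ℝ≥0∞}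
    {g : β → ℝ≥0∞} (hk : Measurable (Function.uncurry k)) (hg : AEMeasurable g ν) {C D : ℝ≥0∞}
    (hC : ∀ᵐ x ∂μ, ∫⁻ y, k x y ∂ν ≤ C) (hD : ∀ᵐ y ∂ν, ∫⁻ x, k x y ∂μ ≤ D) :
    ∫⁻ x, (∫⁻ y, k x y * g y ∂ν) ^ 2 ∂μ ≤ C * D * ∫⁻ y, g y ^ 2 ∂ν := by
  have measurable_left : ∀ y, Measurable fun x => k x y := fun y => hk.of_uncurry_right
  have measurable_right : ∀ x, Measurable (k x) := fun x => hk.of_uncurry_left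
  have pointwise : ∀ᵐ x ∂μ, (∫⁻ y, k x y * g y ∂ν) ^ 2 ≤ C * ∫⁻ y, k x y * g y ^ 2 ∂ν := by
    filter_upwards [hC] with x hx
    have := lintegral_weight_mul_sq_le (f := 1) (measurable_right x).aemeasurable (by fun_prop) hg
    simp only [Pi.one_apply, mul_one, one_pow] at this
    exact this.trans (by gcongr)
  have aemeasurable_product :
      AEMeasurable (Function.uncurry fun x y => k x y * g y ^ 2) (μ.prod ν) :=
    hk.aemeasurable.mul ((hg.comp_quasiMeasurePreserving
      Measure.quasiMeasurePreserving_snd).pow_const 2)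
  calc ∫⁻ x, (∫⁻ y, k x y * g y ∂ν) ^ 2 ∂μ
      ≤ ∫⁻ x, C * ∫⁻ y, k x y * g y ^ 2 ∂ν ∂μ := lintegral_mono_ae pointwise
    _ = C * ∫⁻ x, ∫⁻ y, k x y * g y ^ 2 ∂ν ∂μ :=
      lintegral_const_mul'' _ aemeasurable_product.lintegral_prod_right'
    _ = C * ∫⁻ y, (∫⁻ x, k x y ∂μ) * g y ^ 2 ∂ν := by
      rw [lintegral_lintegral_swap aemeasurable_product]
      simp only [lintegral_mul_const _ (measurable_left _)]
    _ ≤ C * ∫⁻ y, D * g y ^ 2 ∂ν := by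
      gcongr 1
      refine lintegral_mono_ae ?_
      filter_upwards [hD] with y hy
      gcongr
    _ = C * D * ∫⁻ y, g y ^ 2 ∂ν := by
      rw [lintegral_const_mul'' _ (by fun_prop), mul_assoc]

theorem eLpNorm_two_sq {F : Type*} [NormedAddCommGroup F] (f : α → F) :
    eLpNorm f 2 μ ^ 2 = ∫⁻ x, ‖f x‖ₑ ^ 2 ∂μ := by
  simpa using eLpNorm_nnreal_pow_eq_lintegral (μ := μ) (f := f) (p := 2) (by norm_num)

end Inequalities

/-- The weight `|ξ| M / (1 + (ρ s |ξ|)²)` at `a = |ξ|`: the factor `|ξ|` contributed by a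
derivative, times the decay at the frequency `s ξ` of the Fourier transform of a bump of width
`ρ`. -/
noncomputable def frequencyWeight (M ρ s a : ℝ) : ℝ≥0∞ :=
  ENNReal.ofReal (a * (M / (1 + (ρ * (s * a)) ^ 2)))

section FrequencyWeight

variable {M ρ s : ℝ}

theorem measurable_frequencyWeight : Measurable fun p : ℝ × ℝ => frequencyWeight M ρ p.1 p.2 := by
  unfold frequencyWeight
  fun_prop

theorem lintegral_Ioi_frequencyWeight_le {a : ℝ} (ha : 0 ≤ a) (hρ : 0 < ρ) (hM : 0 ≤ M) :
    ∫⁻ s in Ioi (0 : ℝ), frequencyWeight M ρ s a ≤ ENNReal.ofReal (2 * M / ρ) := by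
  rcases ha.eq_or_lt with rfl | ha
  · simp [frequencyWeight]
  have frequencyWeight_eq : ∀ s : ℝ, frequencyWeight M ρ s a =
      ENNReal.ofReal ((fun x => a * M * (1 + x ^ 2)⁻¹) ((ρ * a) * s)) := fun s => by
    simp only [frequencyWeight, div_eq_mul_inv]
    ring_nf
  have integrable_profile : Integrable (fun x : ℝ => a * M * (1 + x ^ 2)⁻¹) :=
    integrable_inv_one_add_sq.const_mul _
  simp only [frequencyWeight_eq]
  rw [← ofReal_integral_eq_lintegral_ofReal
    (integrable_profile.comp_mul_left' (by positivity)).integrableOn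
    (.of_forall fun s => by positivity),
    integral_comp_mul_left_Ioi (fun x => a * M * (1 + x ^ 2)⁻¹) 0 (by positivity), mul_zero,
    integral_const_mul, integral_Ioi_inv_one_add_sq, smul_eq_mul, Real.arctan_zero, sub_zero]
  apply ENNReal.ofReal_le_ofReal
  calc (ρ * a)⁻¹ * (a * M * (Real.pi / 2)) = (M / ρ) * (Real.pi / 2) := by field_simp
    _ ≤ (M / ρ) * 2 := by
      gcongr
      linarith [Real.pi_le_four]
    _ = 2 * M / ρ := by ring

theorem frequencyWeight_le_two_mul {a : ℝ} (ha : 0 ≤ a) (hρ : 0 ≤ ρ) (hM : 0 ≤ M)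
    (hs : s ∈ Ioo (0 : ℝ) (1 / 2)) :
    frequencyWeight M ρ s a ≤ ENNReal.ofReal 2 * frequencyWeight M ρ s ((1 - s) * a) := by
  have hs0 := hs.1
  have one_sub_mul_nonneg : 0 ≤ (1 - s) * a := mul_nonneg (by linarith [hs.2]) ha
  have one_sub_mul_le : (1 - s) * a ≤ a := by nlinarith
  have le_two_mul : a ≤ 2 * ((1 - s) * a) := by nlinarith [hs.2]
  rw [frequencyWeight, frequencyWeight, ← ENNReal.ofReal_mul (by norm_num), ← mul_assoc 2]
  refine ENNReal.ofReal_le_ofReal (mul_le_mul le_two_mul ?_ (by positivity) (by linarith))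
  gcongr

theorem frequencyWeight_le_of_half_le {a : ℝ} (ha : 0 ≤ a) (hρ : 0 < ρ) (hM : 0 ≤ M)
    (hs : 1 / 2 ≤ s) : frequencyWeight M ρ s a ≤ ENNReal.ofReal (M / ρ) := by
  apply ENNReal.ofReal_le_ofReal
  rw [mul_div_left_comm]
  refine (mul_le_mul_of_nonneg_left ?_ hM).trans_eq (mul_one_div M ρ)
  rw [div_le_div_iff₀ (by positivity) hρ]
  have : 0 ≤ a * ρ := by positivity
  nlinarith [sq_nonneg (ρ * (s * a) - 1)]

theorem decay_mul_enorm_le_frequencyWeight {E : Type*} [NormedAddCommGroup E] [NormedSpace ℝ E]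
    {H : E → ℝ≥0∞} (hM : 0 ≤ M)
    (hH : ∀ ξ, H ξ ≤ ENNReal.ofReal (M / (1 + (ρ * ‖ξ‖) ^ 2))) (hs : 0 ≤ s) (ξ : E) :
    H (s • ξ) * ‖ξ‖ₑ ≤ frequencyWeight M ρ s ‖ξ‖ := by
  rw [frequencyWeight, mul_comm ‖ξ‖, ENNReal.ofReal_mul (by positivity), ofReal_norm]
  gcongr
  simpa only [norm_smul, Real.norm_of_nonneg hs] using hH (s • ξ)

variable {E : Type*} [NormedAddCommGroup E] [MeasurableSpace E] [BorelSpace E] {μ : Measure E}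

theorem lintegral_lintegral_frequencyWeight_mul_le [SFinite μ] {G : E → ℝ≥0∞}
    (hG : Measurable G) (hρ : 0 < ρ) (hM : 0 ≤ M) {S : Set ℝ} (hS : S ⊆ Ioi 0) :
    ∫⁻ s in S, ∫⁻ ξ, frequencyWeight M ρ s ‖ξ‖ * G ξ ∂μ ≤
      ENNReal.ofReal (2 * M / ρ) * ∫⁻ ξ, G ξ ∂μ := by
  have measurable_weight : Measurable fun p : ℝ × E => frequencyWeight M ρ p.1 ‖p.2‖ :=
    measurable_frequencyWeight.comp (by fun_prop : Measurable fun p : ℝ × E => (p.1, ‖p.2‖))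
  rw [lintegral_lintegral_swap (by fun_prop), ← lintegral_const_mul _ hG]
  refine lintegral_mono fun ξ => ?_
  have measurable_slice : Measurable fun s => frequencyWeight M ρ s ‖ξ‖ :=
    measurable_weight.comp measurable_prodMk_right
  rw [lintegral_mul_const _ measurable_slice]
  gcongr
  exact (lintegral_mono_set hS).trans (lintegral_Ioi_frequencyWeight_le (norm_nonneg ξ) hρ hM)

variable [NormedSpace ℝ E] [FiniteDimensional ℝ E] [μ.IsAddHaarMeasure]

theorem lintegral_comp_smul_eq (G : E → ℝ≥0∞) (hs : 0 < s) :
    ∫⁻ x, G (s • x) ∂μ = ENNReal.ofReal ((s ^ Module.finrank ℝ E)⁻¹) * ∫⁻ x, G x ∂μ := by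
  have measurableEmbedding : MeasurableEmbedding (fun x : E => s • x) :=
    (Homeomorph.smulOfNeZero s hs.ne').measurableEmbedding
  rw [← measurableEmbedding.lintegral_map G, Measure.map_addHaar_smul μ hs.ne',
    lintegral_smul_measure, abs_of_nonneg (by positivity), smul_eq_mul]

theorem lintegral_frequencyWeight_mul_comp_smul_le {G : E → ℝ≥0∞} (hG : Measurable G)
    (hρ : 0 ≤ ρ) (hM : 0 ≤ M) (hs : s ∈ Ioo (0 : ℝ) (1 / 2)) :
    ∫⁻ ξ, frequencyWeight M ρ s ‖ξ‖ * G ((1 - s) • ξ) ∂μ ≤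
      ENNReal.ofReal (2 ^ (Module.finrank ℝ E + 1)) *
        ∫⁻ ξ, frequencyWeight M ρ s ‖ξ‖ * G ξ ∂μ := by
  have one_sub_pos : 0 < 1 - s := by linarith [hs.2]
  have inv_one_sub_le : (1 - s)⁻¹ ≤ 2 := by
    rw [inv_le_comm₀ one_sub_pos (by norm_num)]
    linarith [hs.2]
  have measurable_weight : Measurable fun ξ : E => frequencyWeight M ρ s ‖ξ‖ := by
    unfold frequencyWeight
    fun_prop
  calc ∫⁻ ξ, frequencyWeight M ρ s ‖ξ‖ * G ((1 - s) • ξ) ∂μ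
      ≤ ∫⁻ ξ, (fun ζ => ENNReal.ofReal 2 * (frequencyWeight M ρ s ‖ζ‖ * G ζ))
          ((1 - s) • ξ) ∂μ := by
        refine lintegral_mono fun ξ => ?_
        simp only [← mul_assoc, norm_smul, Real.norm_of_nonneg one_sub_pos.le]
        gcongr
        exact frequencyWeight_le_two_mul (norm_nonneg ξ) hρ hM hs
    _ = ENNReal.ofReal (((1 - s) ^ Module.finrank ℝ E)⁻¹ * 2) *
        ∫⁻ ξ, frequencyWeight M ρ s ‖ξ‖ * G ξ ∂μ := by
      rw [lintegral_comp_smul_eq (fun ζ => ENNReal.ofReal 2 * (frequencyWeight M ρ s ‖ζ‖ * G ζ))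
        one_sub_pos, lintegral_const_mul _ (by fun_prop), ← mul_assoc,
        ← ENNReal.ofReal_mul (by positivity)]
    _ ≤ ENNReal.ofReal (2 ^ (Module.finrank ℝ E + 1)) *
        ∫⁻ ξ, frequencyWeight M ρ s ‖ξ‖ * G ξ ∂μ := by
      gcongr
      rw [← inv_pow, pow_succ]
      gcongr

end FrequencyWeight

section DilationPairing

variable {E : Type*} [NormedAddCommGroup E] [NormedSpace ℝ E] [FiniteDimensional ℝ E]
  [MeasurableSpace E] [BorelSpace E] {μ : Measure E} [μ.IsAddHaarMeasure]
  {P F H : E → ℝ≥0∞} {M ρ s : ℝ}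

theorem lintegral_dilation_pairing_low_sq_le (hP : Measurable P) (hF : Measurable F)
    (hM : 0 ≤ M) (hρ : 0 < ρ) (hH : ∀ ξ, H ξ ≤ ENNReal.ofReal (M / (1 + (ρ * ‖ξ‖) ^ 2))) :
    (∫⁻ s in Ioo (0 : ℝ) (1 / 2),
        ∫⁻ ξ, F ((1 - s) • ξ) * (H (s • ξ) * (‖ξ‖ₑ * P ξ)) ∂μ) ^ 2 ≤
      ENNReal.ofReal (2 ^ (Module.finrank ℝ E + 3) * (M / ρ) ^ 2) *
        ((∫⁻ ξ, P ξ ^ 2 ∂μ) * ∫⁻ ξ, F ξ ^ 2 ∂μ) := by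
  set τ : Measure ℝ := volume.restrict (Ioo (0 : ℝ) (1 / 2))
  set w : ℝ × E → ℝ≥0∞ := fun p => frequencyWeight M ρ p.1 ‖p.2‖
  have measurable_w : Measurable w :=
    measurable_frequencyWeight.comp (by fun_prop : Measurable fun p : ℝ × E => (p.1, ‖p.2‖))
  have pairing_le : ∫⁻ s, (∫⁻ ξ, F ((1 - s) • ξ) * (H (s • ξ) * (‖ξ‖ₑ * P ξ)) ∂μ) ∂τ ≤
      ∫⁻ p, w p * P p.2 * F ((1 - p.1) • p.2) ∂(τ.prod μ) := by
    rw [lintegral_prod _ (by fun_prop)]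
    refine setLIntegral_mono' measurableSet_Ioo fun s hs => lintegral_mono fun ξ => ?_
    calc _ = H (s • ξ) * ‖ξ‖ₑ * P ξ * F ((1 - s) • ξ) := by ring
      _ ≤ w (s, ξ) * P ξ * F ((1 - s) • ξ) := by
        gcongr
        exact decay_mul_enorm_le_frequencyWeight hM hH hs.1.le ξ
  have weighted_P_le : ∫⁻ p, w p * P p.2 ^ 2 ∂(τ.prod μ) ≤
      ENNReal.ofReal (2 * M / ρ) * ∫⁻ ξ, P ξ ^ 2 ∂μ := by
    rw [lintegral_prod _ (by fun_prop)]
    exact lintegral_lintegral_frequencyWeight_mul_le (hP.pow_const 2) hρ hM Ioo_subset_Ioi_self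
  have weighted_F_le : ∫⁻ p, w p * F ((1 - p.1) • p.2) ^ 2 ∂(τ.prod μ) ≤
      ENNReal.ofReal (2 ^ (Module.finrank ℝ E + 1)) *
        (ENNReal.ofReal (2 * M / ρ) * ∫⁻ ξ, F ξ ^ 2 ∂μ) := by
    rw [lintegral_prod _ (by fun_prop)]
    refine (setLIntegral_mono' measurableSet_Ioo fun s hs =>
      lintegral_frequencyWeight_mul_comp_smul_le (hF.pow_const 2) hρ.le hM hs).trans ?_
    rw [lintegral_const_mul' _ _ ENNReal.ofReal_ne_top]
    gcongr
    exact lintegral_lintegral_frequencyWeight_mul_le (hF.pow_const 2) hρ hM Ioo_subset_Ioi_self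
  refine (pow_le_pow_left' pairing_le 2).trans <|
    (lintegral_weight_mul_sq_le (by fun_prop) (by fun_prop) (by fun_prop)).trans <|
    (mul_le_mul' weighted_P_le weighted_F_le).trans_eq ?_
  rw [show (2 : ℝ) ^ (Module.finrank ℝ E + 3) * (M / ρ) ^ 2 =
      (2 * M / ρ) * (2 ^ (Module.finrank ℝ E + 1) * (2 * M / ρ)) by ring,
    ENNReal.ofReal_mul (by positivity), ENNReal.ofReal_mul (by positivity)]
  ring

theorem lintegral_dilation_pairing_high_sq_le (hP : Measurable P) (hF : Measurable F)
    (hM : 0 ≤ M) (hρ : 0 < ρ) (hH : ∀ ξ, H ξ ≤ ENNReal.ofReal (M / (1 + (ρ * ‖ξ‖) ^ 2)))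
    (hs : 1 / 2 ≤ s) (hs1 : s < 1) :
    (∫⁻ ξ, F ((1 - s) • ξ) * (H (s • ξ) * (‖ξ‖ₑ * P ξ)) ∂μ) ^ 2 ≤
      ENNReal.ofReal ((M / ρ) ^ 2 * ((1 - s) ^ Module.finrank ℝ E)⁻¹) *
        ((∫⁻ ξ, P ξ ^ 2 ∂μ) * ∫⁻ ξ, F ξ ^ 2 ∂μ) := by
  calc (∫⁻ ξ, F ((1 - s) • ξ) * (H (s • ξ) * (‖ξ‖ₑ * P ξ)) ∂μ) ^ 2
      ≤ (∫⁻ ξ, ENNReal.ofReal (M / ρ) * (P ξ * F ((1 - s) • ξ)) ∂μ) ^ 2 := by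
        refine pow_le_pow_left' (lintegral_mono fun ξ => ?_) 2
        calc _ = H (s • ξ) * ‖ξ‖ₑ * (P ξ * F ((1 - s) • ξ)) := by ring
          _ ≤ ENNReal.ofReal (M / ρ) * (P ξ * F ((1 - s) • ξ)) := by
            gcongr
            exact (decay_mul_enorm_le_frequencyWeight hM hH (by linarith) ξ).trans
              (frequencyWeight_le_of_half_le (norm_nonneg ξ) hρ hM hs)
    _ = ENNReal.ofReal (M / ρ) ^ 2 * (∫⁻ ξ, P ξ * F ((1 - s) • ξ) ∂μ) ^ 2 := by
        rw [lintegral_const_mul _ (by fun_prop), mul_pow]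
    _ ≤ ENNReal.ofReal (M / ρ) ^ 2 *
        ((∫⁻ ξ, P ξ ^ 2 ∂μ) * ∫⁻ ξ, F ((1 - s) • ξ) ^ 2 ∂μ) := by
        gcongr
        exact lintegral_mul_sq_le (by fun_prop) (by fun_prop)
    _ = _ := by
        rw [lintegral_comp_smul_eq (fun ξ => F ξ ^ 2) (by linarith : 0 < 1 - s),
          ENNReal.ofReal_mul (by positivity), ENNReal.ofReal_pow (by positivity)]
        ring

theorem lintegral_dilation_pairing_bdd_sq_le {D : E → ℝ≥0∞} (hP : Measurable P)
    (hD : Measurable D) {N : ℝ≥0∞} (hF : ∀ ξ, F ξ ≤ N) (hs : 0 < s) :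
    (∫⁻ ξ, F ((1 - s) • ξ) * (D (s • ξ) * P ξ) ∂μ) ^ 2 ≤
      N ^ 2 * (ENNReal.ofReal ((s ^ Module.finrank ℝ E)⁻¹) * ∫⁻ ξ, D ξ ^ 2 ∂μ) *
        ∫⁻ ξ, P ξ ^ 2 ∂μ := by
  calc (∫⁻ ξ, F ((1 - s) • ξ) * (D (s • ξ) * P ξ) ∂μ) ^ 2
      ≤ (∫⁻ ξ, N * (D (s • ξ) * P ξ) ∂μ) ^ 2 := by
        gcongr with ξ
        exact hF _
    _ = N ^ 2 * (∫⁻ ξ, D (s • ξ) * P ξ ∂μ) ^ 2 := by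
        rw [lintegral_const_mul _ (by fun_prop), mul_pow]
    _ ≤ N ^ 2 * ((∫⁻ ξ, D (s • ξ) ^ 2 ∂μ) * ∫⁻ ξ, P ξ ^ 2 ∂μ) := by
        gcongr
        exact lintegral_mul_sq_le (by fun_prop) (by fun_prop)
    _ = _ := by
        rw [lintegral_comp_smul_eq (fun ξ => D ξ ^ 2) hs]
        ring

end DilationPairing

section Kappa

variable {n ℓ : ℕ} {t : ℝ}

theorem one_le_bogKappa (ht : 1 ≤ t) : 1 ≤ bogKappa n ℓ t := by
  unfold bogKappa
  split_ifs
  · exact le_rfl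
  · have := Real.log_nonneg ht
    simp only [le_add_iff_nonneg_right]
    positivity

theorem rpow_le_bogKappa_of_exp_one_le (hℓn : ℓ ≤ n) (hℓ : (n : ℝ) / 2 + 1 ≤ ℓ)
    (ht : Real.exp 1 ≤ t) : t ^ ((ℓ - 1 : ℝ) / n - 1 / 2) ≤ bogKappa n ℓ t := by
  have cast_le : (ℓ : ℝ) ≤ n := by exact_mod_cast hℓn
  have one_le_t : 1 ≤ t := (Real.one_le_exp zero_le_one).trans ht
  have n_pos : (0 : ℝ) < n := by linarith [(n.cast_nonneg : (0 : ℝ) ≤ n)]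
  have ℓ_sub_one_pos : (0 : ℝ) < ℓ - 1 := by linarith
  have one_le_log : 1 ≤ Real.log t := by rwa [Real.le_log_iff_exp_le (by linarith)]
  have exponent_le : (ℓ - 1 : ℝ) / n - 1 / 2 ≤ (2 * (ℓ - 1) - n) / (2 * (ℓ - 1)) := by
    rw [sub_le_iff_le_add, div_add_div _ _ (by positivity) (by norm_num),
      div_le_div_iff₀ n_pos (by positivity)]
    nlinarith [mul_nonneg (by linarith : (0 : ℝ) ≤ n - (ℓ - 1))
      (by linarith : (0 : ℝ) ≤ 2 * (ℓ - 1) - n)]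
  rw [bogKappa, if_neg hℓ.not_gt]
  calc t ^ ((ℓ - 1 : ℝ) / n - 1 / 2) ≤ t ^ ((2 * (ℓ - 1) - n) / (2 * (ℓ - 1)) : ℝ) :=
        Real.rpow_le_rpow_of_exponent_le one_le_t exponent_le
    _ ≤ Real.log t ^ ((n : ℝ) / (2 * (ℓ - 1))) * t ^ ((2 * (ℓ - 1) - n) / (2 * (ℓ - 1)) : ℝ) :=
      le_mul_of_one_le_left (by positivity) (Real.one_le_rpow one_le_log (by positivity))
    _ ≤ _ := le_add_of_nonneg_left zero_le_one

theorem rpow_le_exp_one_mul_bogKappa (hℓn : ℓ ≤ n) (hℓ : (n : ℝ) / 2 + 1 ≤ ℓ) (ht : 1 ≤ t) :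
    t ^ ((ℓ - 1 : ℝ) / n - 1 / 2) ≤ Real.exp 1 * bogKappa n ℓ t := by
  have cast_le : (ℓ : ℝ) ≤ n := by exact_mod_cast hℓn
  have one_le_kappa : 1 ≤ bogKappa n ℓ t := one_le_bogKappa ht
  rcases le_total t (Real.exp 1) with t_le | le_t
  · calc t ^ ((ℓ - 1 : ℝ) / n - 1 / 2) ≤ t ^ (1 : ℝ) := by
          apply Real.rpow_le_rpow_of_exponent_le ht
          have : (ℓ - 1 : ℝ) / n ≤ 1 := div_le_one_of_le₀ (by linarith) n.cast_nonneg
          linarith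
      _ ≤ Real.exp 1 * 1 := by rwa [Real.rpow_one, mul_one]
      _ ≤ Real.exp 1 * bogKappa n ℓ t := by gcongr
  · exact (rpow_le_bogKappa_of_exp_one_le hℓn hℓ le_t).trans
      (le_mul_of_one_le_left (by linarith) (Real.one_le_exp zero_le_one))

theorem log_le_bogKappa_of_eq (hn : n ≠ 0) (hℓ : (n : ℝ) / 2 + 1 = ℓ) :
    Real.log t ≤ bogKappa n ℓ t := by
  have two_mul_eq : 2 * ((ℓ : ℝ) - 1) = n := by linarith
  rw [bogKappa, if_neg hℓ.le.not_gt, two_mul_eq, div_self (by exact_mod_cast hn), sub_self,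
    zero_div, Real.rpow_one, Real.rpow_zero, mul_one]
  exact le_add_of_nonneg_left zero_le_one

end Kappa

/-- The factor `σ ^ (n - ℓ)` of `Q_ℓ`, with `σ = 1 - s`, times the better of the two bounds
`σ ^ (-n / 2)` and `√t` for the pairing of the slice at `s` with a derivative. They agree at the
crossover `σ = t ^ (-1 / n)`. -/
noncomputable def sliceWeight (n ℓ : ℕ) (t σ : ℝ) : ℝ≥0∞ :=
  ENNReal.ofReal (σ ^ (n - ℓ)) *
    min (ENNReal.ofReal (σ ^ (-(n : ℝ) / 2))) (ENNReal.ofReal (√t))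

section SliceWeight

variable {n ℓ : ℕ} {t σ δ p : ℝ}

theorem sliceWeight_le_rpow (hℓn : ℓ ≤ n) (hσ : 0 < σ) :
    sliceWeight n ℓ t σ ≤ ENNReal.ofReal (σ ^ ((n : ℝ) / 2 - ℓ)) := by
  calc sliceWeight n ℓ t σ
      ≤ ENNReal.ofReal (σ ^ (n - ℓ)) * ENNReal.ofReal (σ ^ (-(n : ℝ) / 2)) :=
        mul_le_mul_right (min_le_left _ _) _
    _ = ENNReal.ofReal (σ ^ ((n : ℝ) / 2 - ℓ)) := by
      rw [← ENNReal.ofReal_mul (by positivity), ← Real.rpow_natCast, ← Real.rpow_add hσ,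
        Nat.cast_sub hℓn]
      congr 2
      ring

theorem sliceWeight_le_pow_mul_sqrt (hσ : 0 ≤ σ) :
    sliceWeight n ℓ t σ ≤ ENNReal.ofReal (σ ^ (n - ℓ) * √t) := by
  rw [ENNReal.ofReal_mul (by positivity)]
  exact mul_le_mul_right (min_le_right _ _) _

theorem lintegral_Ioc_rpow_eq_ofReal_intervalIntegral (hδ : 0 ≤ δ) (hδ1 : δ ≤ 1)
    (hint : IntervalIntegrable (fun σ : ℝ => σ ^ p) volume δ 1) :
    ∫⁻ σ in Ioc δ 1, ENNReal.ofReal (σ ^ p) = ENNReal.ofReal (∫ σ in δ..1, σ ^ p) := by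
  rw [intervalIntegral.integral_of_le hδ1, ofReal_integral_eq_lintegral_ofReal
    ((intervalIntegrable_iff_integrableOn_Ioc_of_le hδ1).1 hint)]
  filter_upwards [ae_restrict_mem measurableSet_Ioc] with σ hσ
  exact Real.rpow_nonneg (hδ.trans hσ.1.le) _

theorem lintegral_sliceWeight_le_of_lt (hℓn : ℓ ≤ n) (hℓ : (ℓ : ℝ) < n / 2 + 1) :
    ∫⁻ σ in Ioc (0 : ℝ) 1, sliceWeight n ℓ t σ ≤ ENNReal.ofReal (1 / ((n : ℝ) / 2 - ℓ + 1)) := by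
  have exponent_gt : -1 < (n : ℝ) / 2 - ℓ := by linarith
  calc ∫⁻ σ in Ioc (0 : ℝ) 1, sliceWeight n ℓ t σ
      ≤ ∫⁻ σ in Ioc (0 : ℝ) 1, ENNReal.ofReal (σ ^ ((n : ℝ) / 2 - ℓ)) :=
        setLIntegral_mono' measurableSet_Ioc fun σ hσ => sliceWeight_le_rpow hℓn hσ.1
    _ = _ := by
      rw [lintegral_Ioc_rpow_eq_ofReal_intervalIntegral le_rfl zero_le_one
        (intervalIntegral.intervalIntegrable_rpow' exponent_gt),
        integral_rpow (Or.inl exponent_gt), Real.one_rpow, Real.zero_rpow (by linarith), sub_zero]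

theorem lintegral_sliceWeight_crossover_le (hn : n ≠ 0) (hℓn : ℓ ≤ n) (ht : 0 < t) :
    ∫⁻ σ in Ioc (0 : ℝ) (t ^ (-1 / n : ℝ)), sliceWeight n ℓ t σ ≤
      ENNReal.ofReal (t ^ ((ℓ - 1 : ℝ) / n - 1 / 2)) := by
  have n_ne_zero : (n : ℝ) ≠ 0 := by exact_mod_cast hn
  set δ : ℝ := t ^ (-1 / n : ℝ) with δ_def
  calc ∫⁻ σ in Ioc (0 : ℝ) δ, sliceWeight n ℓ t σ
      ≤ ∫⁻ _ in Ioc (0 : ℝ) δ, ENNReal.ofReal (δ ^ (n - ℓ) * √t) := by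
        refine setLIntegral_mono' measurableSet_Ioc fun σ hσ =>
          (sliceWeight_le_pow_mul_sqrt hσ.1.le).trans ?_
        have := hσ.1.le
        gcongr
        exact hσ.2
    _ = ENNReal.ofReal (δ ^ (n - ℓ) * √t * δ) := by
      rw [setLIntegral_const, Real.volume_Ioc, sub_zero, ← ENNReal.ofReal_mul (by positivity)]
    _ = ENNReal.ofReal (t ^ ((ℓ - 1 : ℝ) / n - 1 / 2)) := by
      rw [Real.sqrt_eq_rpow, mul_right_comm, ← pow_succ, ← Real.rpow_natCast, δ_def,
        ← Real.rpow_mul ht.le, ← Real.rpow_add ht]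
      push_cast [Nat.cast_sub hℓn]
      congr 2
      field_simp
      ring

theorem intervalIntegrable_rpow_of_pos (hδ : 0 < δ) :
    IntervalIntegrable (fun σ : ℝ => σ ^ p) volume δ 1 :=
  intervalIntegral.intervalIntegrable_rpow (Or.inr (notMem_uIcc_of_lt hδ one_pos))

theorem lintegral_sliceWeight_le_add (hn : n ≠ 0) (hℓn : ℓ ≤ n) (ht : 1 ≤ t) :
    ∫⁻ σ in Ioc (0 : ℝ) 1, sliceWeight n ℓ t σ ≤
      ENNReal.ofReal (t ^ ((ℓ - 1 : ℝ) / n - 1 / 2)) +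
        ENNReal.ofReal (∫ σ in (t ^ (-1 / n : ℝ))..1, σ ^ ((n : ℝ) / 2 - ℓ)) := by
  have t_pos : 0 < t := by linarith
  have δ_pos : 0 < t ^ (-1 / n : ℝ) := Real.rpow_pos_of_pos t_pos _
  have δ_le_one : t ^ (-1 / n : ℝ) ≤ 1 := Real.rpow_le_one_of_one_le_of_nonpos ht
    (div_nonpos_of_nonpos_of_nonneg (by norm_num) n.cast_nonneg)
  rw [← Ioc_union_Ioc_eq_Ioc δ_pos.le δ_le_one,
    ← lintegral_Ioc_rpow_eq_ofReal_intervalIntegral δ_pos.le δ_le_one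
      (intervalIntegrable_rpow_of_pos δ_pos)]
  exact (lintegral_union_le _ _ _).trans <|
    add_le_add (lintegral_sliceWeight_crossover_le hn hℓn t_pos) <|
      setLIntegral_mono' measurableSet_Ioc fun σ hσ => sliceWeight_le_rpow hℓn (δ_pos.trans hσ.1)

theorem integral_rpow_crossover_of_eq (hℓ : (n : ℝ) / 2 + 1 = ℓ) (ht : 0 < t) :
    ∫ σ in (t ^ (-1 / n : ℝ))..1, σ ^ ((n : ℝ) / 2 - ℓ) = 1 / n * Real.log t := by
  rw [show (n : ℝ) / 2 - ℓ = -1 by linarith]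
  simp only [Real.rpow_neg_one]
  rw [integral_inv_of_pos (Real.rpow_pos_of_pos ht _) one_pos, one_div, Real.log_inv,
    Real.log_rpow ht]
  ring

theorem integral_rpow_crossover_le_of_lt (hn : n ≠ 0) (hℓ : (n : ℝ) / 2 + 1 < ℓ) (ht : 0 < t) :
    ∫ σ in (t ^ (-1 / n : ℝ))..1, σ ^ ((n : ℝ) / 2 - ℓ) ≤
      1 / ((ℓ : ℝ) - n / 2 - 1) * t ^ ((ℓ - 1 : ℝ) / n - 1 / 2) := by
  have n_ne_zero : (n : ℝ) ≠ 0 := by exact_mod_cast hn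
  have denominator_pos : 0 < (ℓ : ℝ) - n / 2 - 1 := by linarith
  have crossover_rpow : (t ^ (-1 / n : ℝ)) ^ ((n : ℝ) / 2 - ℓ + 1) =
      t ^ ((ℓ - 1 : ℝ) / n - 1 / 2) := by
    rw [← Real.rpow_mul ht.le]
    congr 1
    field_simp
    ring
  rw [integral_rpow (Or.inr ⟨by linarith, notMem_uIcc_of_lt (Real.rpow_pos_of_pos ht _) one_pos⟩),
    crossover_rpow, Real.one_rpow, ← neg_div_neg_eq, one_div_mul_eq_div]
  rw [show -((n : ℝ) / 2 - ℓ + 1) = ℓ - n / 2 - 1 by ring]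
  gcongr
  linarith

theorem exists_lintegral_sliceWeight_le (hℓn : ℓ ≤ n) :
    ∃ C : ℝ, 0 < C ∧ ∀ t : ℝ, 1 ≤ t →
      ∫⁻ σ in Ioc (0 : ℝ) 1, sliceWeight n ℓ t σ ≤ ENNReal.ofReal (C * bogKappa n ℓ t) := by
  rcases lt_or_ge (ℓ : ℝ) (n / 2 + 1) with subcritical | not_subcritical
  · refine ⟨1 / ((n : ℝ) / 2 - ℓ + 1), one_div_pos.2 (by linarith), fun t _ => ?_⟩
    rw [bogKappa, if_pos subcritical, mul_one]
    exact lintegral_sliceWeight_le_of_lt hℓn subcritical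
  have n_ne_zero : n ≠ 0 := by
    rintro rfl
    norm_num [Nat.le_zero.1 hℓn] at not_subcritical
  suffices ∃ C : ℝ, 0 ≤ C ∧ ∀ t : ℝ, 1 ≤ t →
      ∫ σ in (t ^ (-1 / n : ℝ))..1, σ ^ ((n : ℝ) / 2 - ℓ) ≤ C * bogKappa n ℓ t by
    obtain ⟨C, C_nonneg, tail_le⟩ := this
    refine ⟨Real.exp 1 + C, by positivity, fun t ht => ?_⟩
    have kappa_nonneg : 0 ≤ bogKappa n ℓ t := zero_le_one.trans (one_le_bogKappa ht)
    refine (lintegral_sliceWeight_le_add n_ne_zero hℓn ht).trans ?_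
    rw [add_mul, ENNReal.ofReal_add (by positivity) (by positivity)]
    gcongr
    · exact rpow_le_exp_one_mul_bogKappa hℓn not_subcritical ht
    · exact tail_le t ht
  rcases not_subcritical.eq_or_lt with critical | supercritical
  · refine ⟨1 / n, by positivity, fun t ht => ?_⟩
    rw [integral_rpow_crossover_of_eq critical (by linarith)]
    gcongr
    exact log_le_bogKappa_of_eq n_ne_zero critical
  · have denominator_pos : 0 < (ℓ : ℝ) - n / 2 - 1 := by linarith
    refine ⟨1 / ((ℓ : ℝ) - n / 2 - 1) * Real.exp 1, by positivity, fun t ht => ?_⟩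
    refine (integral_rpow_crossover_le_of_lt n_ne_zero supercritical (by linarith)).trans ?_
    rw [mul_assoc]
    gcongr
    exact rpow_le_exp_one_mul_bogKappa hℓn supercritical.le ht

end SliceWeight

section TestFunctions

variable {n : ℕ} {u : EuclideanSpace ℝ (Fin n) → ℝ}

theorem contDiff_partialDeriv (hu : ContDiff ℝ ∞ u) (j : Fin n) :
    ContDiff ℝ ∞ (partialDeriv j u) :=
  (hu.fderiv_right (by simp)).clm_apply contDiff_const

theorem tsupport_partialDeriv_subset (u : EuclideanSpace ℝ (Fin n) → ℝ) (j : Fin n) :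
    tsupport (partialDeriv j u) ⊆ tsupport u := by
  refine closure_minimal (fun x hx => ?_) (isClosed_tsupport u)
  exact tsupport_fderiv_subset ℝ (subset_closure fun h => hx (by simp [partialDeriv, h]))

theorem hasCompactSupport_partialDeriv (hc : HasCompactSupport u) (j : Fin n) :
    HasCompactSupport (partialDeriv j u) :=
  hc.mono' (subset_closure.trans (tsupport_partialDeriv_subset u j))

/-- A real test function, viewed as a complex-valued Schwartz function. -/
noncomputable def complexSchwartz (u : EuclideanSpace ℝ (Fin n) → ℝ) (hu : ContDiff ℝ ∞ u)
    (hc : HasCompactSupport u) : 𝓢(EuclideanSpace ℝ (Fin n), ℂ) :=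
  HasCompactSupport.toSchwartzMap (f := Complex.ofRealCLM ∘ u) (hc.comp_left rfl) (by fun_prop)

theorem complexSchwartz_apply (hu : ContDiff ℝ ∞ u) (hc : HasCompactSupport u)
    (x : EuclideanSpace ℝ (Fin n)) : complexSchwartz u hu hc x = (u x : ℂ) := rfl

theorem lineDeriv_complexSchwartz (hu : ContDiff ℝ ∞ u) (hc : HasCompactSupport u) (j : Fin n) :
    ∂_{EuclideanSpace.single j (1 : ℝ)} (complexSchwartz u hu hc) =
      complexSchwartz (partialDeriv j u) (contDiff_partialDeriv hu j)
        (hasCompactSupport_partialDeriv hc j) := by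
  ext x
  have hasFDerivAt_complex : HasFDerivAt (complexSchwartz u hu hc)
      (Complex.ofRealCLM.comp (fderiv ℝ u x)) x :=
    Complex.ofRealCLM.hasFDerivAt.comp x (hu.differentiable (by simp) x).hasFDerivAt
  rw [SchwartzMap.lineDerivOp_apply_eq_fderiv, complexSchwartz_apply, hasFDerivAt_complex.fderiv]
  rfl

theorem norm_fourierInv_complexSchwartz_le (hu : ContDiff ℝ ∞ u) (hc : HasCompactSupport u)
    (ξ : EuclideanSpace ℝ (Fin n)) : ‖𝓕⁻ (complexSchwartz u hu hc) ξ‖ ≤ ∫ x, |u x| := by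
  rw [SchwartzMap.fourierInv_coe]
  refine (norm_fourierInv_le_integral_norm _ _).trans_eq ?_
  simp only [complexSchwartz_apply, Complex.norm_real, Real.norm_eq_abs]

theorem sq_mul_norm_fourierInv_complexSchwartz_le (hu : ContDiff ℝ ∞ u)
    (hc : HasCompactSupport u) (j : Fin n) (ξ : EuclideanSpace ℝ (Fin n)) :
    ξ j ^ 2 * ‖𝓕⁻ (complexSchwartz u hu hc) ξ‖ ≤
      ∫ x, |partialDeriv j (partialDeriv j u) x| := by
  set v := EuclideanSpace.single j (1 : ℝ) with v_def
  have inner_eq : inner ℝ ξ v = ξ j := by simp [v, EuclideanSpace.inner_single_right]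
  have one_le_two_pi_sq : 1 ≤ (2 * Real.pi) * (2 * Real.pi) := by nlinarith [Real.pi_gt_three]
  calc ξ j ^ 2 * ‖𝓕⁻ (complexSchwartz u hu hc) ξ‖
      ≤ (2 * Real.pi * (2 * Real.pi)) * (ξ j ^ 2 * ‖𝓕⁻ (complexSchwartz u hu hc) ξ‖) :=
        le_mul_of_one_le_left (by positivity) one_le_two_pi_sq
    _ = ‖𝓕⁻ (∂_{v} (∂_{v} (complexSchwartz u hu hc))) ξ‖ := by
      rw [norm_fourierInv_lineDeriv, norm_fourierInv_lineDeriv, inner_eq, ← sq_abs (ξ j)]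
      ring
    _ ≤ ∫ x, |partialDeriv j (partialDeriv j u) x| := by
      simp only [v_def, lineDeriv_complexSchwartz]
      exact norm_fourierInv_complexSchwartz_le _ _ ξ

end TestFunctions

/-- A smooth function `η` supported in `closedBall c ρ` which is a bump of mass `A` at scale `ρ`:
its derivatives of order at most two in `L¹`, and at most one in `L^∞`, obey the corresponding
scaling bounds. These are the only properties of the kernel `θ` that the estimate uses, and the
class is stable under multiplication by `x_m - c_m`. -/
structure IsBump {n : ℕ} (A : ℝ) (c : EuclideanSpace ℝ (Fin n)) (ρ : ℝ)
    (η : EuclideanSpace ℝ (Fin n) → ℝ) : Prop where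
  contDiff : ContDiff ℝ ∞ η
  tsupport_subset : tsupport η ⊆ Metric.closedBall c ρ
  integral_abs_le : ∫ x, |η x| ≤ A
  integral_abs_deriv_le : ∀ j, ∫ x, |partialDeriv j η x| ≤ A / ρ
  integral_abs_deriv_deriv_le :
    ∀ j, ∫ x, |partialDeriv j (partialDeriv j η) x| ≤ A / ρ ^ 2
  abs_le : ∀ x, |η x| ≤ A / ρ ^ n
  abs_deriv_le : ∀ j x, |partialDeriv j η x| ≤ A / ρ ^ (n + 1)

namespace IsBump

variable {n : ℕ} {A ρ : ℝ} {c : EuclideanSpace ℝ (Fin n)} {η : EuclideanSpace ℝ (Fin n) → ℝ}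

theorem nonneg (hη : IsBump A c ρ η) : 0 ≤ A :=
  (integral_nonneg fun _ => abs_nonneg _).trans hη.integral_abs_le

theorem hasCompactSupport (hη : IsBump A c ρ η) : HasCompactSupport η :=
  (isCompact_closedBall c ρ).of_isClosed_subset (isClosed_tsupport η) hη.tsupport_subset

theorem integrable (hη : IsBump A c ρ η) : Integrable η :=
  hη.contDiff.continuous.integrable_of_hasCompactSupport hη.hasCompactSupport

theorem integrable_partialDeriv (hη : IsBump A c ρ η) (j : Fin n) :
    Integrable (partialDeriv j η) :=
  (contDiff_partialDeriv hη.contDiff j).continuous.integrable_of_hasCompactSupport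
    (hasCompactSupport_partialDeriv hη.hasCompactSupport j)

/-- The complexification of a bump. -/
noncomputable def toSchwartz (hη : IsBump A c ρ η) : 𝓢(EuclideanSpace ℝ (Fin n), ℂ) :=
  complexSchwartz η hη.contDiff hη.hasCompactSupport

theorem norm_fourierInv_toSchwartz_le (hη : IsBump A c ρ η) (hρ : 0 < ρ)
    (ξ : EuclideanSpace ℝ (Fin n)) :
    ‖𝓕⁻ hη.toSchwartz ξ‖ ≤ (n + 1) * A / (1 + (ρ * ‖ξ‖) ^ 2) := by
  have coord_le : ∀ j, ρ ^ 2 * (ξ j ^ 2 * ‖𝓕⁻ hη.toSchwartz ξ‖) ≤ A := fun j => by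
    rw [← le_div_iff₀' (by positivity)]
    exact (sq_mul_norm_fourierInv_complexSchwartz_le _ _ j ξ).trans
      (hη.integral_abs_deriv_deriv_le j)
  rw [le_div_iff₀ (by positivity)]
  calc ‖𝓕⁻ hη.toSchwartz ξ‖ * (1 + (ρ * ‖ξ‖) ^ 2)
      = ‖𝓕⁻ hη.toSchwartz ξ‖ + ∑ j, ρ ^ 2 * (ξ j ^ 2 * ‖𝓕⁻ hη.toSchwartz ξ‖) := by
        rw [mul_pow, EuclideanSpace.norm_sq_eq, ← Finset.mul_sum, ← Finset.sum_mul]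
        simp only [Real.norm_eq_abs, sq_abs]
        ring
    _ ≤ A + ∑ _j : Fin n, A := by
      gcongr with j
      · exact (norm_fourierInv_complexSchwartz_le _ _ ξ).trans hη.integral_abs_le
      · exact coord_le j
    _ = (n + 1) * A := by
      rw [Finset.sum_const, Finset.card_univ, Fintype.card_fin, nsmul_eq_mul]
      ring

theorem enorm_fourierInv_toSchwartz_le (hη : IsBump A c ρ η) (hρ : 0 < ρ)
    (ξ : EuclideanSpace ℝ (Fin n)) :
    ‖𝓕⁻ (hη.toSchwartz : EuclideanSpace ℝ (Fin n) → ℂ) ξ‖ₑ ≤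
      ENNReal.ofReal ((n + 1) * A / (1 + (ρ * ‖ξ‖) ^ 2)) := by
  rw [← SchwartzMap.fourierInv_coe, ← ofReal_norm]
  exact ENNReal.ofReal_le_ofReal (hη.norm_fourierInv_toSchwartz_le hρ ξ)

theorem lintegral_fourierInv_lineDeriv_sq_le (hη : IsBump A c ρ η) (hρ : 0 < ρ) (j : Fin n) :
    ∫⁻ ξ, ‖𝓕⁻ (∂_{EuclideanSpace.single j (1 : ℝ)} hη.toSchwartz) ξ‖ₑ ^ 2 ≤
      ENNReal.ofReal (A ^ 2 / ρ ^ (n + 2)) := by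
  set D := ∂_{EuclideanSpace.single j (1 : ℝ)} hη.toSchwartz with D_def
  have A_nonneg := hη.nonneg
  have D_apply : ∀ x, D x = (partialDeriv j η x : ℂ) := fun x => by
    rw [D_def, toSchwartz, lineDeriv_complexSchwartz, complexSchwartz_apply]
  rw [← eLpNorm_two_sq, SchwartzMap.fourierInv_coe, eLpNorm_fourierInv_eq D.integrable (D.memLp 2),
    eLpNorm_two_sq]
  calc ∫⁻ x, ‖D x‖ₑ ^ 2
      ≤ ∫⁻ x, ENNReal.ofReal (A / ρ ^ (n + 1)) * ENNReal.ofReal |partialDeriv j η x| := by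
        refine lintegral_mono fun x => ?_
        rw [D_apply, ← ofReal_norm, Complex.norm_real, Real.norm_eq_abs, pow_two]
        gcongr
        exact hη.abs_deriv_le j x
    _ = ENNReal.ofReal (A / ρ ^ (n + 1) * ∫ x, |partialDeriv j η x|) := by
        rw [lintegral_const_mul' _ _ ENNReal.ofReal_ne_top, ENNReal.ofReal_mul (by positivity),
          ofReal_integral_eq_lintegral_ofReal (hη.integrable_partialDeriv j).abs
            (.of_forall fun x => abs_nonneg _)]
    _ ≤ ENNReal.ofReal (A / ρ ^ (n + 1) * (A / ρ)) := by
        gcongr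
        exact hη.integral_abs_deriv_le j
    _ = ENNReal.ofReal (A ^ 2 / ρ ^ (n + 2)) := by
        congr 1
        field_simp
        ring

end IsBump

section CoordMul

variable {n : ℕ} {A ρ : ℝ} {c x : EuclideanSpace ℝ (Fin n)} {η : EuclideanSpace ℝ (Fin n) → ℝ}

theorem partialDeriv_coord_sub_mul (hη : DifferentiableAt ℝ η x) (m j : Fin n) (a : ℝ) :
    partialDeriv j (fun z => (z m - a) * η z) x =
      (if m = j then η x else 0) + (x m - a) * partialDeriv j η x := by
  have hasFDerivAt_coord : HasFDerivAt (fun z : EuclideanSpace ℝ (Fin n) => z m - a)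
      (EuclideanSpace.proj m : EuclideanSpace ℝ (Fin n) →L[ℝ] ℝ) x :=
    (EuclideanSpace.proj m : EuclideanSpace ℝ (Fin n) →L[ℝ] ℝ).hasFDerivAt.sub_const a
  have hasFDerivAt_mul : HasFDerivAt (fun z => (z m - a) * η z) _ x :=
    hasFDerivAt_coord.mul hη.hasFDerivAt
  rw [partialDeriv, hasFDerivAt_mul.fderiv]
  simp only [add_apply, smul_apply, smul_eq_mul,
    PiLp.proj_apply, PiLp.single_apply, mul_ite, mul_one, mul_zero, partialDeriv]
  exact add_comm _ _

theorem partialDeriv_partialDeriv_coord_sub_mul (hη : ContDiff ℝ ∞ η) (m j : Fin n) (a : ℝ) :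
    partialDeriv j (partialDeriv j fun z => (z m - a) * η z) x =
      (if m = j then 2 * partialDeriv j η x else 0) +
        (x m - a) * partialDeriv j (partialDeriv j η) x := by
  have differentiable_η : Differentiable ℝ η := hη.differentiable (by simp)
  have differentiable_deriv : Differentiable ℝ (partialDeriv j η) :=
    (contDiff_partialDeriv hη j).differentiable (by simp)
  have deriv_eq : (partialDeriv j fun z => (z m - a) * η z) =
      (fun z => if m = j then η z else 0) + fun z => (z m - a) * partialDeriv j η z := by
    ext z
    exact partialDeriv_coord_sub_mul (differentiable_η z) m j a
  have differentiableAt_ite : DifferentiableAt ℝ (fun z => if m = j then η z else 0) x := by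
    split_ifs
    exacts [differentiable_η x, differentiableAt_const 0]
  have differentiableAt_mul : DifferentiableAt ℝ (fun z => (z m - a) * partialDeriv j η z) x := by
    fun_prop
  rw [deriv_eq, partialDeriv, fderiv_add differentiableAt_ite differentiableAt_mul]
  change partialDeriv j _ x + partialDeriv j _ x = _
  rw [partialDeriv_coord_sub_mul (differentiable_deriv x)]
  split_ifs
  · ring
  · simp [partialDeriv]

theorem abs_coord_sub_coord_le (x y : EuclideanSpace ℝ (Fin n)) (m : Fin n) :
    |x m - y m| ≤ dist x y := by
  simpa [dist_eq_norm] using PiLp.norm_apply_le (x - y) m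

theorem abs_coord_sub_mul_le (hη : tsupport η ⊆ Metric.closedBall c ρ) (m : Fin n) :
    |(x m - c m) * η x| ≤ ρ * |η x| := by
  by_cases hx : x ∈ tsupport η
  · rw [abs_mul]
    gcongr
    exact (abs_coord_sub_coord_le x c m).trans (hη hx)
  · simp [image_eq_zero_of_notMem_tsupport hx]

theorem abs_partialDeriv_coord_sub_mul_le (hη : ContDiff ℝ ∞ η)
    (hs : tsupport η ⊆ Metric.closedBall c ρ) (m j : Fin n) :
    |partialDeriv j (fun z => (z m - c m) * η z) x| ≤ |η x| + ρ * |partialDeriv j η x| := by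
  rw [partialDeriv_coord_sub_mul (hη.differentiable (by simp) x)]
  refine (abs_add_le _ _).trans (add_le_add ?_ (abs_coord_sub_mul_le
    ((tsupport_partialDeriv_subset η j).trans hs) m))
  split_ifs <;> simp

theorem abs_partialDeriv_partialDeriv_coord_sub_mul_le (hη : ContDiff ℝ ∞ η)
    (hs : tsupport η ⊆ Metric.closedBall c ρ) (m j : Fin n) :
    |partialDeriv j (partialDeriv j fun z => (z m - c m) * η z) x| ≤
      2 * |partialDeriv j η x| + ρ * |partialDeriv j (partialDeriv j η) x| := by
  rw [partialDeriv_partialDeriv_coord_sub_mul hη]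
  refine (abs_add_le _ _).trans (add_le_add ?_ (abs_coord_sub_mul_le
    (((tsupport_partialDeriv_subset _ j).trans (tsupport_partialDeriv_subset η j)).trans hs) m))
  split_ifs <;> simp

namespace IsBump

theorem integral_abs_coord_sub_mul_le (hη : IsBump A c ρ η) (hρ : 0 < ρ) (m : Fin n) :
    ∫ x, |(x m - c m) * η x| ≤ 3 * A * ρ := by
  have A_nonneg := hη.nonneg
  calc ∫ x, |(x m - c m) * η x|
      ≤ ∫ x, ρ * |η x| :=
        integral_mono_of_nonneg (.of_forall fun x => abs_nonneg _)
          (hη.integrable.abs.const_mul ρ)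
          (.of_forall fun x => abs_coord_sub_mul_le hη.tsupport_subset m)
    _ ≤ ρ * A := by
        rw [integral_const_mul]
        gcongr
        exact hη.integral_abs_le
    _ ≤ 3 * A * ρ := by nlinarith

theorem integral_abs_deriv_coord_sub_mul_le (hη : IsBump A c ρ η) (hρ : 0 < ρ) (m j : Fin n) :
    ∫ x, |partialDeriv j (fun z => (z m - c m) * η z) x| ≤ 3 * A * ρ / ρ := by
  have integrable_deriv := hη.integrable_partialDeriv j
  calc ∫ x, |partialDeriv j (fun z => (z m - c m) * η z) x|
      ≤ ∫ x, (|η x| + ρ * |partialDeriv j η x|) :=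
        integral_mono_of_nonneg (.of_forall fun x => abs_nonneg _)
          (hη.integrable.abs.add (integrable_deriv.abs.const_mul ρ))
          (.of_forall fun x => abs_partialDeriv_coord_sub_mul_le hη.contDiff hη.tsupport_subset m j)
    _ ≤ A + ρ * (A / ρ) := by
        rw [integral_add hη.integrable.abs (integrable_deriv.abs.const_mul ρ), integral_const_mul]
        gcongr
        exacts [hη.integral_abs_le, hη.integral_abs_deriv_le j]
    _ = 2 * A * ρ / ρ := by
        field_simp
        ring
    _ ≤ 3 * A * ρ / ρ := by
        have A_nonneg := hη.nonneg
        gcongr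
        norm_num

theorem integral_abs_deriv_deriv_coord_sub_mul_le (hη : IsBump A c ρ η) (hρ : 0 < ρ)
    (m j : Fin n) :
    ∫ x, |partialDeriv j (partialDeriv j fun z => (z m - c m) * η z) x| ≤ 3 * A * ρ / ρ ^ 2 := by
  have integrable_deriv := hη.integrable_partialDeriv j
  have integrable_deriv_deriv : Integrable (partialDeriv j (partialDeriv j η)) :=
    (contDiff_partialDeriv (contDiff_partialDeriv hη.contDiff j) j).continuous
      |>.integrable_of_hasCompactSupport
        (hasCompactSupport_partialDeriv (hasCompactSupport_partialDeriv hη.hasCompactSupport j) j)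
  calc ∫ x, |partialDeriv j (partialDeriv j fun z => (z m - c m) * η z) x|
      ≤ ∫ x, (2 * |partialDeriv j η x| + ρ * |partialDeriv j (partialDeriv j η) x|) :=
        integral_mono_of_nonneg (.of_forall fun x => abs_nonneg _)
          ((integrable_deriv.abs.const_mul 2).add (integrable_deriv_deriv.abs.const_mul ρ))
          (.of_forall fun x =>
            abs_partialDeriv_partialDeriv_coord_sub_mul_le hη.contDiff hη.tsupport_subset m j)
    _ ≤ 2 * (A / ρ) + ρ * (A / ρ ^ 2) := by
        rw [integral_add (integrable_deriv.abs.const_mul 2)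
            (integrable_deriv_deriv.abs.const_mul ρ),
          integral_const_mul, integral_const_mul]
        gcongr
        exacts [hη.integral_abs_deriv_le j, hη.integral_abs_deriv_deriv_le j]
    _ = 3 * A * ρ / ρ ^ 2 := by
        field_simp
        ring

theorem coord_sub_mul (hη : IsBump A c ρ η) (hρ : 0 < ρ) (m : Fin n) :
    IsBump (3 * A * ρ) c ρ (fun z => (z m - c m) * η z) where
  contDiff := by
    have := hη.contDiff
    fun_prop
  tsupport_subset := tsupport_mul_subset_right.trans hη.tsupport_subset
  integral_abs_le := hη.integral_abs_coord_sub_mul_le hρ m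
  integral_abs_deriv_le := hη.integral_abs_deriv_coord_sub_mul_le hρ m
  integral_abs_deriv_deriv_le := hη.integral_abs_deriv_deriv_coord_sub_mul_le hρ m
  abs_le x := by
    have A_nonneg := hη.nonneg
    calc |(x m - c m) * η x|
        ≤ ρ * (A / ρ ^ n) :=
          (abs_coord_sub_mul_le hη.tsupport_subset m).trans (by gcongr; exact hη.abs_le x)
      _ = A * ρ / ρ ^ n := by ring
      _ ≤ 3 * A * ρ / ρ ^ n := by
          gcongr
          linarith
  abs_deriv_le j x := by
    have A_nonneg := hη.nonneg
    calc |partialDeriv j (fun z => (z m - c m) * η z) x|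
        ≤ A / ρ ^ n + ρ * (A / ρ ^ (n + 1)) := by
          refine (abs_partialDeriv_coord_sub_mul_le hη.contDiff hη.tsupport_subset m j).trans ?_
          gcongr
          exacts [hη.abs_le x, hη.abs_deriv_le j x]
      _ = 2 * A * ρ / ρ ^ (n + 1) := by
          field_simp
          ring
      _ ≤ 3 * A * ρ / ρ ^ (n + 1) := by
          gcongr
          norm_num

end IsBump

end CoordMul

section Pairing

variable {n : ℕ}

/-- The Fourier side of the bilinear form `∫ h(y) ∫ η(z) ψ((1 - s) y + s z) dz dy`, with absolute
values inside the integral. -/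
noncomputable def fourierSlice (η h : EuclideanSpace ℝ (Fin n) → ℂ)
    (ψ : 𝓢(EuclideanSpace ℝ (Fin n), ℂ)) (s : ℝ) : ℝ≥0∞ :=
  ∫⁻ ξ, ‖𝓕⁻ h ((1 - s) • ξ)‖ₑ * (‖𝓕⁻ η (s • ξ)‖ₑ * ‖𝓕 ψ ξ‖ₑ)

variable {A ρ s t b : ℝ} {c : EuclideanSpace ℝ (Fin n)} {η : EuclideanSpace ℝ (Fin n) → ℝ}
  {h : EuclideanSpace ℝ (Fin n) → ℂ}

theorem measurable_fourierSlice {η : EuclideanSpace ℝ (Fin n) → ℂ} (hη : Integrable η)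
    (hh : Integrable h) (ψ : 𝓢(EuclideanSpace ℝ (Fin n), ℂ)) :
    Measurable (fourierSlice η h ψ) := by
  have continuous_η := continuous_fourierInv hη
  have continuous_h := continuous_fourierInv hh
  have continuous_ψ := (𝓕 ψ).continuous
  have measurable_h : Measurable fun p : ℝ × EuclideanSpace ℝ (Fin n) =>
      𝓕⁻ h ((1 - p.1) • p.2) := continuous_h.measurable.comp (by fun_prop)
  have measurable_η : Measurable fun p : ℝ × EuclideanSpace ℝ (Fin n) => 𝓕⁻ η (p.1 • p.2) :=
    continuous_η.measurable.comp (by fun_prop)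
  exact Measurable.lintegral_prod_right' (f := fun p : ℝ × EuclideanSpace ℝ (Fin n) =>
    ‖𝓕⁻ h ((1 - p.1) • p.2)‖ₑ * (‖𝓕⁻ η (p.1 • p.2)‖ₑ * ‖𝓕 ψ p.2‖ₑ)) (by fun_prop)

theorem enorm_fourier_lineDeriv_single_le (φ : 𝓢(EuclideanSpace ℝ (Fin n), ℂ)) (j : Fin n)
    (ξ : EuclideanSpace ℝ (Fin n)) :
    ‖𝓕 (∂_{EuclideanSpace.single j (1 : ℝ)} φ) ξ‖ₑ ≤
      ‖ξ‖ₑ * (ENNReal.ofReal (2 * Real.pi) * ‖𝓕 φ ξ‖ₑ) := by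
  have inner_le : |inner ℝ ξ (EuclideanSpace.single j (1 : ℝ))| ≤ ‖ξ‖ := by
    simpa using abs_real_inner_le_norm ξ (EuclideanSpace.single j (1 : ℝ))
  simp only [← ofReal_norm]
  rw [norm_fourier_lineDeriv, ← ENNReal.ofReal_mul (by positivity),
    ← ENNReal.ofReal_mul (by positivity)]
  refine ENNReal.ofReal_le_ofReal ?_
  calc 2 * Real.pi * |inner ℝ ξ (EuclideanSpace.single j (1 : ℝ))| * ‖𝓕 φ ξ‖
      ≤ 2 * Real.pi * ‖ξ‖ * ‖𝓕 φ ξ‖ := by gcongr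
    _ = ‖ξ‖ * (2 * Real.pi * ‖𝓕 φ ξ‖) := by ring

theorem enorm_fourierInv_mul_enorm_fourier_lineDeriv (η φ : 𝓢(EuclideanSpace ℝ (Fin n), ℂ))
    (v ξ : EuclideanSpace ℝ (Fin n)) (hs : 0 < s) :
    ‖𝓕⁻ η (s • ξ)‖ₑ * ‖𝓕 (∂_{v} φ) ξ‖ₑ =
      ‖𝓕⁻ (∂_{v} η) (s • ξ)‖ₑ * (ENNReal.ofReal s⁻¹ * ‖𝓕 φ ξ‖ₑ) := by
  simp only [← ofReal_norm]
  rw [norm_fourier_lineDeriv, norm_fourierInv_lineDeriv, real_inner_smul_left, abs_mul,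
    abs_of_pos hs, ← ENNReal.ofReal_mul (by positivity), ← ENNReal.ofReal_mul (by positivity),
    ← ENNReal.ofReal_mul (by positivity)]
  congr 1
  field_simp

theorem eLpNorm_fourier_eq (φ : 𝓢(EuclideanSpace ℝ (Fin n), ℂ)) :
    eLpNorm (𝓕 φ : 𝓢(EuclideanSpace ℝ (Fin n), ℂ)) 2 volume = eLpNorm φ 2 volume := by
  rw [← eLpNorm_fourierInv_eq (𝓕 φ).integrable ((𝓕 φ).memLp 2), ← SchwartzMap.fourierInv_coe,
    FourierTransform.fourierInv_fourier_eq (F := 𝓢(EuclideanSpace ℝ (Fin n), ℂ))]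

theorem lintegral_const_mul_enorm_fourier_sq (φ : 𝓢(EuclideanSpace ℝ (Fin n), ℂ)) {a : ℝ}
    (ha : 0 ≤ a) :
    ∫⁻ ξ, (ENNReal.ofReal a * ‖𝓕 φ ξ‖ₑ) ^ 2 =
      ENNReal.ofReal (a ^ 2) * eLpNorm φ 2 volume ^ 2 := by
  have continuous_φ := (𝓕 φ).continuous
  simp only [mul_pow]
  rw [lintegral_const_mul _ (by fun_prop), ← eLpNorm_fourier_eq, eLpNorm_two_sq,
    ENNReal.ofReal_pow ha]

theorem lintegral_fourier_sq_mul_lintegral_fourierInv_sq (hh : Integrable h)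
    (h2 : MemLp h 2 volume) (φ : 𝓢(EuclideanSpace ℝ (Fin n), ℂ)) {a k : ℝ} (ha : 0 ≤ a)
    (hk : 0 ≤ k) :
    ENNReal.ofReal k *
        ((∫⁻ ξ, (ENNReal.ofReal a * ‖𝓕 φ ξ‖ₑ) ^ 2) * ∫⁻ ξ, ‖𝓕⁻ h ξ‖ₑ ^ 2) =
      ENNReal.ofReal (k * a ^ 2) * (eLpNorm h 2 volume * eLpNorm φ 2 volume) ^ 2 := by
  rw [lintegral_const_mul_enorm_fourier_sq φ ha, ← eLpNorm_two_sq, eLpNorm_fourierInv_eq hh h2,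
    ENNReal.ofReal_mul hk]
  ring

theorem fourierSlice_lineDeriv_le (η : EuclideanSpace ℝ (Fin n) → ℂ)
    (φ : 𝓢(EuclideanSpace ℝ (Fin n), ℂ)) (j : Fin n) (s : ℝ) :
    fourierSlice η h (∂_{EuclideanSpace.single j (1 : ℝ)} φ) s ≤
      ∫⁻ ξ, ‖𝓕⁻ h ((1 - s) • ξ)‖ₑ *
        (‖𝓕⁻ η (s • ξ)‖ₑ * (‖ξ‖ₑ * (ENNReal.ofReal (2 * Real.pi) * ‖𝓕 φ ξ‖ₑ))) := by
  refine lintegral_mono fun ξ => ?_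
  gcongr
  exact enorm_fourier_lineDeriv_single_le φ j ξ

theorem fourierSlice_lineDeriv_eq (η φ : 𝓢(EuclideanSpace ℝ (Fin n), ℂ))
    (h : EuclideanSpace ℝ (Fin n) → ℂ) {v : EuclideanSpace ℝ (Fin n)} (hs : 0 < s) :
    fourierSlice η h (∂_{v} φ) s =
      ∫⁻ ξ, ‖𝓕⁻ h ((1 - s) • ξ)‖ₑ *
        (‖𝓕⁻ (∂_{v} η) (s • ξ)‖ₑ * (ENNReal.ofReal s⁻¹ * ‖𝓕 φ ξ‖ₑ)) := by
  refine lintegral_congr fun ξ => ?_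
  rw [← enorm_fourierInv_mul_enorm_fourier_lineDeriv _ _ _ _ hs, SchwartzMap.fourierInv_coe]

theorem enorm_fourierInv_le_lintegral (h : EuclideanSpace ℝ (Fin n) → ℂ)
    (ξ : EuclideanSpace ℝ (Fin n)) : ‖𝓕⁻ h ξ‖ₑ ≤ ∫⁻ x, ‖h x‖ₑ := by
  rw [Real.fourierInv_eq]
  refine (enorm_integral_le_lintegral_enorm _).trans_eq ?_
  simp only [← ofReal_norm, Circle.norm_smul]

theorem le_ofReal_mul_of_sq_le {X Y : ℝ≥0∞} {a : ℝ} (ha : 0 ≤ a)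
    (hX : X ^ 2 ≤ ENNReal.ofReal (a ^ 2) * Y ^ 2) : X ≤ ENNReal.ofReal a * Y := by
  rw [ENNReal.ofReal_pow ha, ← mul_pow] at hX
  exact (ENNReal.pow_le_pow_left_iff two_ne_zero).mp hX

namespace IsBump

theorem lintegral_fourierSlice_low_le (hη : IsBump A c ρ η) (hρ : 0 < ρ) (hh : Integrable h)
    (h2 : MemLp h 2 volume) (φ : 𝓢(EuclideanSpace ℝ (Fin n), ℂ)) (j : Fin n) :
    ∫⁻ s in Ioo (0 : ℝ) (1 / 2), fourierSlice hη.toSchwartz h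
        (∂_{EuclideanSpace.single j (1 : ℝ)} φ) s ≤
      ENNReal.ofReal (2 ^ (n + 2) * ((n + 1) * (2 * Real.pi)) * (A / ρ)) *
        (eLpNorm h 2 volume * eLpNorm φ 2 volume) := by
  have A_nonneg := hη.nonneg
  have continuous_φ := (𝓕 φ).continuous
  have continuous_h := continuous_fourierInv hh
  have low_sq_le := lintegral_dilation_pairing_low_sq_le
    (μ := (volume : Measure (EuclideanSpace ℝ (Fin n))))
    (P := fun ξ => ENNReal.ofReal (2 * Real.pi) * ‖𝓕 φ ξ‖ₑ) (F := fun ξ => ‖𝓕⁻ h ξ‖ₑ)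
    (H := fun ξ => ‖𝓕⁻ (hη.toSchwartz : EuclideanSpace ℝ (Fin n) → ℂ) ξ‖ₑ)
    (by fun_prop) (by fun_prop) (M := (n + 1) * A) (by positivity) hρ
    (hη.enorm_fourierInv_toSchwartz_le hρ)
  rw [lintegral_fourier_sq_mul_lintegral_fourierInv_sq hh h2 φ (by positivity) (by positivity),
    finrank_euclideanSpace_fin] at low_sq_le
  have constant_le : 2 ^ (n + 3) * ((n + 1) * A / ρ) ^ 2 * (2 * Real.pi) ^ 2 ≤
      (2 ^ (n + 2) * ((n + 1) * (2 * Real.pi)) * (A / ρ)) ^ 2 := by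
    have pow_le : (2 : ℝ) ^ (n + 3) ≤ (2 ^ (n + 2)) ^ 2 := by
      rw [← pow_mul]
      exact pow_le_pow_right₀ one_le_two (by omega)
    calc 2 ^ (n + 3) * ((n + 1) * A / ρ) ^ 2 * (2 * Real.pi) ^ 2
        ≤ (2 ^ (n + 2)) ^ 2 * ((n + 1) * A / ρ) ^ 2 * (2 * Real.pi) ^ 2 := by gcongr
      _ = (2 ^ (n + 2) * ((n + 1) * (2 * Real.pi)) * (A / ρ)) ^ 2 := by ring
  refine le_ofReal_mul_of_sq_le (by positivity) ?_
  calc (∫⁻ s in Ioo (0 : ℝ) (1 / 2), fourierSlice hη.toSchwartz h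
          (∂_{EuclideanSpace.single j (1 : ℝ)} φ) s) ^ 2
      ≤ (∫⁻ s in Ioo (0 : ℝ) (1 / 2), ∫⁻ ξ, ‖𝓕⁻ h ((1 - s) • ξ)‖ₑ *
          (‖𝓕⁻ (hη.toSchwartz : EuclideanSpace ℝ (Fin n) → ℂ) (s • ξ)‖ₑ *
            (‖ξ‖ₑ * (ENNReal.ofReal (2 * Real.pi) * ‖𝓕 φ ξ‖ₑ)))) ^ 2 :=
        pow_le_pow_left' (lintegral_mono fun s => fourierSlice_lineDeriv_le _ φ j s) 2
    _ ≤ _ := low_sq_le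
    _ ≤ _ := mul_le_mul_left (ENNReal.ofReal_le_ofReal constant_le) _

theorem fourierSlice_high_le (hη : IsBump A c ρ η) (hρ : 0 < ρ) (hh : Integrable h)
    (h2 : MemLp h 2 volume) (φ : 𝓢(EuclideanSpace ℝ (Fin n), ℂ)) (j : Fin n)
    (hs : 1 / 2 ≤ s) (hs1 : s < 1) :
    fourierSlice hη.toSchwartz h (∂_{EuclideanSpace.single j (1 : ℝ)} φ) s ≤
      ENNReal.ofReal ((n + 1) * (2 * Real.pi) * (A / ρ) * (1 - s) ^ (-(n : ℝ) / 2)) *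
        (eLpNorm h 2 volume * eLpNorm φ 2 volume) := by
  have A_nonneg := hη.nonneg
  have continuous_φ := (𝓕 φ).continuous
  have continuous_h := continuous_fourierInv hh
  have one_sub_pos : 0 < 1 - s := by linarith
  have high_sq_le := lintegral_dilation_pairing_high_sq_le
    (μ := (volume : Measure (EuclideanSpace ℝ (Fin n))))
    (P := fun ξ => ENNReal.ofReal (2 * Real.pi) * ‖𝓕 φ ξ‖ₑ) (F := fun ξ => ‖𝓕⁻ h ξ‖ₑ)
    (H := fun ξ => ‖𝓕⁻ (hη.toSchwartz : EuclideanSpace ℝ (Fin n) → ℂ) ξ‖ₑ)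
    (by fun_prop) (by fun_prop) (M := (n + 1) * A) (by positivity) hρ
    (hη.enorm_fourierInv_toSchwartz_le hρ) hs hs1
  rw [lintegral_fourier_sq_mul_lintegral_fourierInv_sq hh h2 φ (by positivity) (by positivity),
    finrank_euclideanSpace_fin] at high_sq_le
  have rpow_sq : ((1 - s) ^ (-(n : ℝ) / 2)) ^ 2 = ((1 - s) ^ n)⁻¹ := by
    rw [← Real.rpow_natCast, ← Real.rpow_mul one_sub_pos.le, ← Real.rpow_natCast,
      ← Real.rpow_neg one_sub_pos.le]
    congr 1
    push_cast
    ring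
  refine le_ofReal_mul_of_sq_le (by positivity) ?_
  refine (pow_le_pow_left' (fourierSlice_lineDeriv_le _ φ j s) 2).trans
    (high_sq_le.trans_eq ?_)
  rw [mul_pow _ ((1 - s) ^ _), rpow_sq]
  congr 2
  ring

theorem fourierSlice_bdd_le (hη : IsBump A c ρ η) (hρ : 0 < ρ) (hb : 0 ≤ b) (ht : 0 ≤ t)
    (hN : (∫⁻ x, ‖h x‖ₑ) ^ 2 ≤ ENNReal.ofReal (t * (b * ρ ^ n)) * eLpNorm h 2 volume ^ 2)
    (φ : 𝓢(EuclideanSpace ℝ (Fin n), ℂ)) (j : Fin n) (hs : 1 / 2 ≤ s) :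
    fourierSlice hη.toSchwartz h (∂_{EuclideanSpace.single j (1 : ℝ)} φ) s ≤
      ENNReal.ofReal (√(2 ^ (n + 2) * b) * (A / ρ) * √t) *
        (eLpNorm h 2 volume * eLpNorm φ 2 volume) := by
  have A_nonneg := hη.nonneg
  have s_pos : 0 < s := by linarith
  have inv_le : s⁻¹ ≤ 2 := inv_le_of_inv_le₀ (by norm_num) (by linarith)
  set v := EuclideanSpace.single j (1 : ℝ)
  have continuous_φ := (𝓕 φ).continuous
  have continuous_η := (𝓕⁻ (∂_{v} hη.toSchwartz)).continuous
  have bdd_sq_le := lintegral_dilation_pairing_bdd_sq_le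
    (μ := (volume : Measure (EuclideanSpace ℝ (Fin n))))
    (P := fun ξ => ENNReal.ofReal s⁻¹ * ‖𝓕 φ ξ‖ₑ) (F := fun ξ => ‖𝓕⁻ h ξ‖ₑ)
    (D := fun ξ => ‖𝓕⁻ (∂_{v} hη.toSchwartz) ξ‖ₑ) (by fun_prop) (by fun_prop)
    (enorm_fourierInv_le_lintegral h) s_pos
  rw [lintegral_const_mul_enorm_fourier_sq φ (by positivity), finrank_euclideanSpace_fin]
    at bdd_sq_le
  refine le_ofReal_mul_of_sq_le (by positivity) ?_
  rw [fourierSlice_lineDeriv_eq _ _ _ s_pos]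
  refine bdd_sq_le.trans ?_
  calc _ ≤ ENNReal.ofReal (t * (b * ρ ^ n)) * eLpNorm h 2 volume ^ 2 *
          (ENNReal.ofReal (2 ^ n) * ENNReal.ofReal (A ^ 2 / ρ ^ (n + 2))) *
          (ENNReal.ofReal (2 ^ 2) * eLpNorm φ 2 volume ^ 2) := by
        rw [← inv_pow]
        gcongr
        exact hη.lintegral_fourierInv_lineDeriv_sq_le hρ j
    _ = ENNReal.ofReal (t * (b * ρ ^ n) * (2 ^ n * (A ^ 2 / ρ ^ (n + 2))) * 2 ^ 2) *
          (eLpNorm h 2 volume * eLpNorm φ 2 volume) ^ 2 := by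
        rw [ENNReal.ofReal_mul (q := 2 ^ 2) (by positivity),
          ENNReal.ofReal_mul (p := t * (b * ρ ^ n)) (by positivity),
          ENNReal.ofReal_mul (p := 2 ^ n) (by positivity)]
        ring
    _ = ENNReal.ofReal ((√(2 ^ (n + 2) * b) * (A / ρ) * √t) ^ 2) *
          (eLpNorm h 2 volume * eLpNorm φ 2 volume) ^ 2 := by
        congr 2
        rw [mul_pow, mul_pow, Real.sq_sqrt (by positivity), Real.sq_sqrt ht]
        field_simp
        ring

theorem fourierSlice_le_mul_min (hη : IsBump A c ρ η) (hρ : 0 < ρ) (hb : 0 ≤ b) (ht : 0 ≤ t)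
    (hh : Integrable h) (h2 : MemLp h 2 volume)
    (hN : (∫⁻ x, ‖h x‖ₑ) ^ 2 ≤ ENNReal.ofReal (t * (b * ρ ^ n)) * eLpNorm h 2 volume ^ 2)
    (φ : 𝓢(EuclideanSpace ℝ (Fin n), ℂ)) (j : Fin n) (hs : 1 / 2 ≤ s) (hs1 : s < 1) :
    fourierSlice hη.toSchwartz h (∂_{EuclideanSpace.single j (1 : ℝ)} φ) s ≤
      ENNReal.ofReal (((n + 1) * (2 * Real.pi) + √(2 ^ (n + 2) * b)) * (A / ρ)) *
        (eLpNorm h 2 volume * eLpNorm φ 2 volume) *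
        min (ENNReal.ofReal ((1 - s) ^ (-(n : ℝ) / 2))) (ENNReal.ofReal √t) := by
  have A_nonneg := hη.nonneg
  rw [mul_right_comm, mul_min, min_mul, ← ENNReal.ofReal_mul (by positivity),
    ← ENNReal.ofReal_mul (by positivity)]
  refine le_min ((hη.fourierSlice_high_le hρ hh h2 φ j hs hs1).trans ?_)
    ((hη.fourierSlice_bdd_le hρ hb ht hN φ j hs).trans ?_)
  · gcongr
    exact le_add_of_nonneg_right (by positivity)
  · gcongr
    exact le_add_of_nonneg_left (by positivity)

end IsBump

theorem lintegral_one_sub_le {g : ℝ → ℝ≥0∞} (hg : Measurable g) :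
    ∫⁻ s in Ico (1 / 2 : ℝ) 1, g (1 - s) ≤ ∫⁻ σ in Ioc (0 : ℝ) 1, g σ := by
  rw [← (Measure.measurePreserving_sub_left (volume : Measure ℝ) 1).setLIntegral_comp_preimage
    measurableSet_Ioc hg]
  exact lintegral_mono_set fun s hs => ⟨by linarith [hs.2], by linarith [hs.1]⟩

theorem IsBump.lintegral_fourierSlice_high_le (hη : IsBump A c ρ η) (hρ : 0 < ρ) (hb : 0 ≤ b)
    (ht : 0 ≤ t) (hh : Integrable h) (h2 : MemLp h 2 volume)
    (hN : (∫⁻ x, ‖h x‖ₑ) ^ 2 ≤ ENNReal.ofReal (t * (b * ρ ^ n)) * eLpNorm h 2 volume ^ 2)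
    (φ : 𝓢(EuclideanSpace ℝ (Fin n), ℂ)) (j : Fin n) (ℓ : ℕ) :
    ∫⁻ s in Ico (1 / 2 : ℝ) 1, ENNReal.ofReal ((1 - s) ^ (n - ℓ)) *
        fourierSlice hη.toSchwartz h (∂_{EuclideanSpace.single j (1 : ℝ)} φ) s ≤
      ENNReal.ofReal (((n + 1) * (2 * Real.pi) + √(2 ^ (n + 2) * b)) * (A / ρ)) *
        (eLpNorm h 2 volume * eLpNorm φ 2 volume) *
        ∫⁻ σ in Ioc (0 : ℝ) 1, sliceWeight n ℓ t σ := by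
  have measurable_weight : Measurable (sliceWeight n ℓ t) := by
    unfold sliceWeight
    fun_prop
  set X := ENNReal.ofReal (((n + 1) * (2 * Real.pi) + √(2 ^ (n + 2) * b)) * (A / ρ)) *
    (eLpNorm h 2 volume * eLpNorm φ 2 volume)
  calc ∫⁻ s in Ico (1 / 2 : ℝ) 1, ENNReal.ofReal ((1 - s) ^ (n - ℓ)) *
        fourierSlice hη.toSchwartz h (∂_{EuclideanSpace.single j (1 : ℝ)} φ) s
      ≤ ∫⁻ s in Ico (1 / 2 : ℝ) 1, X * sliceWeight n ℓ t (1 - s) := by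
        refine setLIntegral_mono' measurableSet_Ico fun s hs => ?_
        rw [sliceWeight, mul_left_comm]
        gcongr
        exact hη.fourierSlice_le_mul_min hρ hb ht hh h2 hN φ j hs.1 hs.2
    _ = X * ∫⁻ s in Ico (1 / 2 : ℝ) 1, sliceWeight n ℓ t (1 - s) :=
        lintegral_const_mul _ (by fun_prop)
    _ ≤ X * ∫⁻ σ in Ioc (0 : ℝ) 1, sliceWeight n ℓ t σ :=
        mul_le_mul_right (lintegral_one_sub_le measurable_weight) X

theorem lintegral_one_sub_pow_mul_le (k : ℕ) (g : ℝ → ℝ≥0∞) :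
    ∫⁻ s in Ioo (0 : ℝ) (1 / 2), ENNReal.ofReal ((1 - s) ^ k) * g s ≤
      ∫⁻ s in Ioo (0 : ℝ) (1 / 2), g s :=
  setLIntegral_mono' measurableSet_Ioo fun s hs => mul_le_of_le_one_left' <|
    ENNReal.ofReal_le_one.2 (pow_le_one₀ (by linarith [hs.2]) (by linarith [hs.1]))

theorem exists_lintegral_fourierSlice_le {n ℓ : ℕ} (hℓn : ℓ ≤ n) {b : ℝ} (hb : 0 ≤ b) :
    ∃ C : ℝ, 0 < C ∧ ∀ {A ρ t : ℝ} {c : EuclideanSpace ℝ (Fin n)}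
      {η : EuclideanSpace ℝ (Fin n) → ℝ} {h : EuclideanSpace ℝ (Fin n) → ℂ}
      (hη : IsBump A c ρ η) (φ : 𝓢(EuclideanSpace ℝ (Fin n), ℂ)) (j : Fin n),
      0 < ρ → 1 ≤ t → Integrable h → MemLp h 2 volume →
      (∫⁻ x, ‖h x‖ₑ) ^ 2 ≤ ENNReal.ofReal (t * (b * ρ ^ n)) * eLpNorm h 2 volume ^ 2 →
      ∫⁻ s in Ioo (0 : ℝ) 1, ENNReal.ofReal ((1 - s) ^ (n - ℓ)) *
          fourierSlice hη.toSchwartz h (∂_{EuclideanSpace.single j (1 : ℝ)} φ) s ≤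
        ENNReal.ofReal (C * (A / ρ) * bogKappa n ℓ t) *
          (eLpNorm h 2 volume * eLpNorm φ 2 volume) := by
  obtain ⟨Cw, Cw_pos, weight_le⟩ := exists_lintegral_sliceWeight_le hℓn
  set C₁ : ℝ := 2 ^ (n + 2) * ((n + 1) * (2 * Real.pi))
  set C₂ : ℝ := (n + 1) * (2 * Real.pi) + √(2 ^ (n + 2) * b)
  refine ⟨C₁ + C₂ * Cw, by positivity, ?_⟩
  intro A ρ t c η h hη φ j hρ ht hh h2 hN
  have A_nonneg := hη.nonneg
  have one_le_kappa : 1 ≤ bogKappa n ℓ t := one_le_bogKappa ht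
  set Y := eLpNorm h 2 volume * eLpNorm φ 2 volume
  set S := fourierSlice hη.toSchwartz h (∂_{EuclideanSpace.single j (1 : ℝ)} φ)
  have low_le : ∫⁻ s in Ioo (0 : ℝ) (1 / 2), ENNReal.ofReal ((1 - s) ^ (n - ℓ)) * S s ≤
      ENNReal.ofReal (C₁ * (A / ρ) * bogKappa n ℓ t) * Y :=
    (lintegral_one_sub_pow_mul_le (n - ℓ) S).trans <|
      (hη.lintegral_fourierSlice_low_le hρ hh h2 φ j).trans <|
        mul_le_mul_left (ENNReal.ofReal_le_ofReal
          (le_mul_of_one_le_right (by positivity) one_le_kappa)) Y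
  have high_le : ∫⁻ s in Ico (1 / 2 : ℝ) 1, ENNReal.ofReal ((1 - s) ^ (n - ℓ)) * S s ≤
      ENNReal.ofReal (C₂ * Cw * (A / ρ) * bogKappa n ℓ t) * Y := by
    refine (hη.lintegral_fourierSlice_high_le hρ hb (by linarith) hh h2 hN φ j ℓ).trans ?_
    refine (mul_le_mul_right (weight_le t ht) _).trans_eq ?_
    rw [mul_right_comm, ← ENNReal.ofReal_mul (by positivity)]
    congr 2
    ring
  rw [← Ioo_union_Ico_eq_Ioo (b := (1 / 2 : ℝ)) (by norm_num) (by norm_num)]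
  refine (lintegral_union_le _ _ _).trans ((add_le_add low_le high_le).trans_eq ?_)
  rw [← add_mul, ← ENNReal.ofReal_add (by positivity) (by positivity)]
  congr 2
  ring

end Pairing

section Kernel

variable {n ℓ : ℕ} {θ f : EuclideanSpace ℝ (Fin n) → ℝ} {m : Fin n}
  {Ω : Set (EuclideanSpace ℝ (Fin n))} {R s : ℝ} {x y : EuclideanSpace ℝ (Fin n)}

theorem lintegral_eq_lintegral_convex_comb (G : EuclideanSpace ℝ (Fin n) → ℝ≥0∞)
    (y : EuclideanSpace ℝ (Fin n)) (hs : 0 < s) :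
    ∫⁻ x, G x = ENNReal.ofReal (s ^ n) * ∫⁻ z, G ((1 - s) • y + s • z) := by
  rw [lintegral_comp_smul_eq (fun z => G ((1 - s) • y + z)) hs, finrank_euclideanSpace_fin,
    lintegral_add_left_eq_self (μ := volume) G, ← mul_assoc, ← ENNReal.ofReal_mul (by positivity),
    mul_inv_cancel₀ (by positivity), ENNReal.ofReal_one, one_mul]

theorem integral_eq_integral_convex_comb (G : EuclideanSpace ℝ (Fin n) → ℝ)
    (y : EuclideanSpace ℝ (Fin n)) (hs : 0 < s) :
    ∫ x, G x = s ^ n * ∫ z, G ((1 - s) • y + s • z) := by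
  rw [Measure.integral_comp_smul volume (fun z => G ((1 - s) • y + z)) s,
    finrank_euclideanSpace_fin, integral_add_left_eq_self (μ := volume) G,
    abs_of_pos (by positivity), smul_eq_mul, ← mul_assoc, mul_inv_cancel₀ (by positivity), one_mul]

theorem add_inv_smul_convex_comb_sub (hs : 0 < s) (y z : EuclideanSpace ℝ (Fin n)) :
    y + s⁻¹ • ((1 - s) • y + s • z - y) = z := by
  have sub_eq : (1 - s) • y + s • z - y = s • (z - y) := by module
  rw [sub_eq, inv_smul_smul₀ hs.ne', add_sub_cancel]

theorem bogIntegrand_convex_comb (hs : 0 < s) (y z : EuclideanSpace ℝ (Fin n)) :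
    bogIntegrand ℓ θ m f ((1 - s) • y + s • z) s y =
      (1 - s) ^ (n - ℓ) * (θ z * (z m - y m) * f y) / s ^ n := by
  have coord_eq : (((1 - s) • y + s • z) m - y m) / s = z m - y m := by
    simp only [PiLp.add_apply, PiLp.smul_apply, smul_eq_mul]
    field_simp
    ring
  rw [bogIntegrand, add_inv_smul_convex_comb_sub hs, coord_eq]

/-- Lebesgue measure on `(0, 1) × ℝⁿ`, the range of the variables `(s, y)` in `bogReduced`. -/
noncomputable abbrev sliceMeasure (n : ℕ) : Measure (ℝ × EuclideanSpace ℝ (Fin n)) :=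
  (volume.restrict (Ioo (0 : ℝ) 1)).prod volume

theorem lintegral_comp_snd_sliceMeasure {G : EuclideanSpace ℝ (Fin n) → ℝ≥0∞}
    (hG : AEMeasurable G) : ∫⁻ p, G p.2 ∂sliceMeasure n = ∫⁻ y, G y := by
  rw [lintegral_prod _ hG.comp_snd]
  simp

theorem ae_sliceMeasure_of_support (hfΩ : ∀ᵐ y ∂volume, y ∉ Ω → f y = 0) :
    ∀ᵐ p ∂sliceMeasure n, p.1 ∈ Ioo (0 : ℝ) 1 ∧ (p.2 ∉ Ω → f p.2 = 0) :=
  (Measure.quasiMeasurePreserving_fst.ae (ae_restrict_mem measurableSet_Ioo)).and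
    (Measure.quasiMeasurePreserving_snd.ae hfΩ)

/-- The kernel `|θ(y + (x - y) / s)| s⁻ⁿ`, restricted to `y ∈ Ω`, which dominates `bogIntegrand`
and to which Schur's test applies. -/
noncomputable def bogKernel (θ : EuclideanSpace ℝ (Fin n) → ℝ)
    (Ω : Set (EuclideanSpace ℝ (Fin n))) (x : EuclideanSpace ℝ (Fin n))
    (p : ℝ × EuclideanSpace ℝ (Fin n)) : ℝ≥0∞ :=
  ENNReal.ofReal (p.1 ^ n)⁻¹ * (Ω.indicator 1 p.2 * ‖θ (p.2 + p.1⁻¹ • (x - p.2))‖ₑ)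

theorem measurable_bogKernel (hθ : Continuous θ) (hΩ : MeasurableSet Ω) :
    Measurable (Function.uncurry (bogKernel θ Ω)) := by
  have measurable_θ := hθ.measurable
  unfold Function.uncurry bogKernel
  fun_prop

theorem enorm_bogIntegrand_le (hR : ∀ z, θ z ≠ 0 → ∀ y ∈ Ω, |z m - y m| ≤ R)
    (hs : s ∈ Ioo (0 : ℝ) 1) (hy : y ∉ Ω → f y = 0) :
    ‖bogIntegrand ℓ θ m f x s y‖ₑ ≤
      bogKernel θ Ω x (s, y) * (ENNReal.ofReal R * ‖f y‖ₑ) := by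
  obtain ⟨s_pos, s_lt⟩ := hs
  obtain ⟨z, rfl⟩ : ∃ z, x = (1 - s) • y + s • z :=
    ⟨y + s⁻¹ • (x - y), by rw [smul_add, smul_inv_smul₀ s_pos.ne']; module⟩
  rw [bogIntegrand_convex_comb s_pos, bogKernel, add_inv_smul_convex_comb_sub s_pos]
  by_cases hfy : f y = 0
  · simp [hfy]
  by_cases hθz : θ z = 0
  · simp [hθz]
  have y_mem : y ∈ Ω := not_imp_comm.mp hy hfy
  have coord_le := hR z hθz y y_mem
  have R_nonneg : 0 ≤ R := (abs_nonneg _).trans coord_le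
  have weight_le : |(1 - s) ^ (n - ℓ)| ≤ 1 := by
    rw [abs_pow, abs_of_pos (by linarith)]
    exact pow_le_one₀ (by linarith) (by linarith)
  rw [indicator_of_mem y_mem, Pi.one_apply, one_mul]
  simp only [← ofReal_norm, Real.norm_eq_abs]
  rw [← ENNReal.ofReal_mul (by positivity), ← ENNReal.ofReal_mul (by positivity),
    ← ENNReal.ofReal_mul (by positivity)]
  refine ENNReal.ofReal_le_ofReal ?_
  rw [abs_div, abs_mul, abs_mul, abs_mul, abs_of_pos (pow_pos s_pos n)]
  calc |(1 - s) ^ (n - ℓ)| * (|θ z| * |z m - y m| * |f y|) / s ^ n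
      ≤ 1 * (|θ z| * R * |f y|) / s ^ n := by gcongr
    _ = (s ^ n)⁻¹ * |θ z| * (R * |f y|) := by ring

theorem lintegral_bogKernel_left_le (θ : EuclideanSpace ℝ (Fin n) → ℝ)
    (Ω : Set (EuclideanSpace ℝ (Fin n))) (hs : 0 < s) (y : EuclideanSpace ℝ (Fin n)) :
    ∫⁻ x, bogKernel θ Ω x (s, y) ≤ ∫⁻ z, ‖θ z‖ₑ := by
  rw [lintegral_eq_lintegral_convex_comb _ y hs, ← lintegral_const_mul' _ _ ENNReal.ofReal_ne_top]
  refine lintegral_mono fun z => ?_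
  simp only [bogKernel, add_inv_smul_convex_comb_sub hs]
  rw [← mul_assoc, ← ENNReal.ofReal_mul (by positivity), mul_inv_cancel₀ (by positivity),
    ENNReal.ofReal_one, one_mul]
  exact mul_le_of_le_one_left' (indicator_le_self' (fun _ _ => zero_le_one) y)

theorem lintegral_bogKernel_right_low_le (θ : EuclideanSpace ℝ (Fin n) → ℝ)
    (Ω : Set (EuclideanSpace ℝ (Fin n))) (hs : 0 < s) (hs2 : s ≤ 1 / 2)
    (x : EuclideanSpace ℝ (Fin n)) :
    ∫⁻ y, bogKernel θ Ω x (s, y) ≤ ENNReal.ofReal (2 ^ n) * ∫⁻ z, ‖θ z‖ₑ := by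
  have one_sub_pos : 0 < 1 - s := by linarith
  have arg_eq : ∀ y, y + s⁻¹ • (x - y) = s⁻¹ • x - ((1 - s) / s) • y := fun y => by
    have ratio_eq : (1 - s) / s = s⁻¹ - 1 := by field_simp
    rw [ratio_eq]
    module
  calc ∫⁻ y, bogKernel θ Ω x (s, y)
      ≤ ∫⁻ y, ENNReal.ofReal (s ^ n)⁻¹ * ‖θ (s⁻¹ • x - ((1 - s) / s) • y)‖ₑ := by
        refine lintegral_mono fun y => ?_
        simp only [bogKernel, arg_eq]
        gcongr
        exact mul_le_of_le_one_left' (indicator_le_self' (fun _ _ => zero_le_one) y)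
    _ = ENNReal.ofReal ((1 - s)⁻¹ ^ n) * ∫⁻ z, ‖θ z‖ₑ := by
        rw [lintegral_const_mul' _ _ ENNReal.ofReal_ne_top,
          lintegral_comp_smul_eq (fun z => ‖θ (s⁻¹ • x - z)‖ₑ) (by positivity),
          finrank_euclideanSpace_fin, lintegral_sub_left_eq_self (fun z => ‖θ z‖ₑ), ← mul_assoc,
          ← ENNReal.ofReal_mul (by positivity), ← inv_pow, ← inv_pow, ← mul_pow]
        congr 3
        field_simp
    _ ≤ ENNReal.ofReal (2 ^ n) * ∫⁻ z, ‖θ z‖ₑ := by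
        gcongr
        exact inv_le_of_inv_le₀ (by norm_num) (by linarith)

theorem lintegral_bogKernel_right_high_le (hΩ : MeasurableSet Ω) {B : ℝ} (hB : ∀ z, ‖θ z‖ ≤ B)
    (hs : 1 / 2 ≤ s) (x : EuclideanSpace ℝ (Fin n)) :
    ∫⁻ y, bogKernel θ Ω x (s, y) ≤
      ENNReal.ofReal (2 ^ n) * (volume Ω * ENNReal.ofReal B) := by
  calc ∫⁻ y, bogKernel θ Ω x (s, y)
      ≤ ∫⁻ y, ENNReal.ofReal (s⁻¹ ^ n) * Ω.indicator (fun _ => ENNReal.ofReal B) y := by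
        refine lintegral_mono fun y => ?_
        simp only [bogKernel, inv_pow]
        gcongr
        by_cases hy : y ∈ Ω
        · simp only [indicator_of_mem hy, Pi.one_apply, one_mul, ← ofReal_norm]
          exact ENNReal.ofReal_le_ofReal (hB _)
        · simp [indicator_of_notMem hy]
    _ = ENNReal.ofReal (s⁻¹ ^ n) * (volume Ω * ENNReal.ofReal B) := by
        rw [lintegral_const_mul' _ _ ENNReal.ofReal_ne_top, lintegral_indicator hΩ,
          setLIntegral_const, mul_comm (volume Ω)]
    _ ≤ ENNReal.ofReal (2 ^ n) * (volume Ω * ENNReal.ofReal B) := by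
        gcongr
        exact inv_le_of_inv_le₀ (by norm_num) (by linarith)

theorem lintegral_bogKernel_sliceMeasure_le (hθ : Continuous θ) (hΩ : MeasurableSet Ω) {B : ℝ}
    (hB : ∀ z, ‖θ z‖ ≤ B) (x : EuclideanSpace ℝ (Fin n)) :
    ∫⁻ p, bogKernel θ Ω x p ∂sliceMeasure n ≤
      ENNReal.ofReal (2 ^ n) * ((∫⁻ z, ‖θ z‖ₑ) + volume Ω * ENNReal.ofReal B) := by
  rw [lintegral_prod _ ((measurable_bogKernel hθ hΩ).of_uncurry_left).aemeasurable]
  calc ∫⁻ s in Ioo (0 : ℝ) 1, ∫⁻ y, bogKernel θ Ω x (s, y)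
      ≤ ∫⁻ _ in Ioo (0 : ℝ) 1,
          ENNReal.ofReal (2 ^ n) * ((∫⁻ z, ‖θ z‖ₑ) + volume Ω * ENNReal.ofReal B) := by
        refine setLIntegral_mono' measurableSet_Ioo fun s hs => ?_
        rw [mul_add]
        rcases le_total s (1 / 2) with hs2 | hs2
        · exact (lintegral_bogKernel_right_low_le θ Ω hs.1 hs2 x).trans le_self_add
        · exact (lintegral_bogKernel_right_high_le hΩ hB hs2 x).trans le_add_self
    _ = _ := by simp

theorem aestronglyMeasurable_bogIntegrand (hθ : Continuous θ)
    (hf : AEStronglyMeasurable f volume) :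
    AEStronglyMeasurable (fun q : EuclideanSpace ℝ (Fin n) × (ℝ × EuclideanSpace ℝ (Fin n)) =>
      bogIntegrand ℓ θ m f q.1 q.2.1 q.2.2) (volume.prod (sliceMeasure n)) := by
  have measurable_θ := hθ.measurable
  have measurable_factor :
      Measurable fun q : EuclideanSpace ℝ (Fin n) × (ℝ × EuclideanSpace ℝ (Fin n)) =>
        (1 - q.2.1) ^ (n - ℓ) * (θ (q.2.2 + q.2.1⁻¹ • (q.1 - q.2.2)) *
          ((q.1 m - q.2.2 m) / q.2.1)) / q.2.1 ^ n := by fun_prop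
  refine (measurable_factor.aestronglyMeasurable.mul hf.comp_snd.comp_snd).congr
    (.of_forall fun q => ?_)
  simp only [bogIntegrand, Pi.mul_apply]
  ring

theorem integrable_bogIntegrand (hθ : Continuous θ) (hc : HasCompactSupport θ)
    (hf : Integrable f) (hfΩ : ∀ᵐ y ∂volume, y ∉ Ω → f y = 0)
    (hR : ∀ z, θ z ≠ 0 → ∀ y ∈ Ω, |z m - y m| ≤ R) :
    Integrable (fun q : EuclideanSpace ℝ (Fin n) × (ℝ × EuclideanSpace ℝ (Fin n)) =>
      bogIntegrand ℓ θ m f q.1 q.2.1 q.2.2) (volume.prod (sliceMeasure n)) := by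
  have measurable_integrand := aestronglyMeasurable_bogIntegrand (ℓ := ℓ) (m := m) hθ hf.1
  have integrable_θ : Integrable θ := hθ.integrable_of_hasCompactSupport hc
  refine ⟨measurable_integrand, ?_⟩
  rw [hasFiniteIntegral_iff_enorm, lintegral_prod_symm _ measurable_integrand.enorm]
  calc ∫⁻ p, (∫⁻ x, ‖bogIntegrand ℓ θ m f x p.1 p.2‖ₑ) ∂sliceMeasure n
      ≤ ∫⁻ p, (∫⁻ z, ‖θ z‖ₑ) * (ENNReal.ofReal R * ‖f p.2‖ₑ) ∂sliceMeasure n := by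
        refine lintegral_mono_ae ?_
        filter_upwards [ae_sliceMeasure_of_support hfΩ] with p hp
        refine (lintegral_mono fun x => enorm_bogIntegrand_le hR hp.1 hp.2).trans ?_
        rw [lintegral_mul_const' _ _ (by finiteness)]
        gcongr ?_ * _
        exact lintegral_bogKernel_left_le θ Ω hp.1.1 p.2
    _ = (∫⁻ z, ‖θ z‖ₑ) * (ENNReal.ofReal R * ∫⁻ y, ‖f y‖ₑ) := by
        rw [lintegral_comp_snd_sliceMeasure (G := fun y => (∫⁻ z, ‖θ z‖ₑ) *
          (ENNReal.ofReal R * ‖f y‖ₑ)) ((hf.1.enorm.const_mul _).const_mul _),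
          lintegral_const_mul'' _ (hf.1.enorm.const_mul _), lintegral_const_mul'' _ hf.1.enorm]
    _ < ⊤ := ENNReal.mul_lt_top integrable_θ.2 (ENNReal.mul_lt_top ENNReal.ofReal_lt_top hf.2)

theorem bogReduced_ae_eq (hθ : Continuous θ) (hc : HasCompactSupport θ) (hf : Integrable f)
    (hfΩ : ∀ᵐ y ∂volume, y ∉ Ω → f y = 0) (hR : ∀ z, θ z ≠ 0 → ∀ y ∈ Ω, |z m - y m| ≤ R) :
    bogReduced ℓ θ m f =ᵐ[volume]
      fun x => ∫ p, bogIntegrand ℓ θ m f x p.1 p.2 ∂sliceMeasure n := by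
  filter_upwards [(integrable_bogIntegrand (ℓ := ℓ) hθ hc hf hfΩ hR).prod_right_ae] with x hx
  exact (integral_prod _ hx).symm

theorem memLp_bogReduced (hθ : Continuous θ) (hc : HasCompactSupport θ) (hΩ : MeasurableSet Ω)
    (hΩ_fin : volume Ω ≠ ⊤) (hf : Integrable f) (hf2 : MemLp f 2 volume)
    (hfΩ : ∀ᵐ y ∂volume, y ∉ Ω → f y = 0) (hR : ∀ z, θ z ≠ 0 → ∀ y ∈ Ω, |z m - y m| ≤ R) :
    MemLp (bogReduced ℓ θ m f) 2 volume := by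
  obtain ⟨B, hB⟩ := hθ.bounded_above_of_compact_support hc
  have integrable_θ : Integrable θ := hθ.integrable_of_hasCompactSupport hc
  have lintegral_f_sq_lt_top : ∫⁻ y, (ENNReal.ofReal R * ‖f y‖ₑ) ^ 2 < ⊤ := by
    simp only [mul_pow]
    rw [lintegral_const_mul' _ _ (by finiteness), ← eLpNorm_two_sq]
    exact ENNReal.mul_lt_top (by finiteness) (ENNReal.pow_lt_top hf2.2)
  refine (memLp_congr_ae (bogReduced_ae_eq hθ hc hf hfΩ hR)).2
    ⟨(integrable_bogIntegrand hθ hc hf hfΩ hR).integral_prod_left.1, ?_⟩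
  refine (ENNReal.pow_lt_top_iff.mp ?_).resolve_right two_ne_zero
  rw [eLpNorm_two_sq]
  calc ∫⁻ x, ‖∫ p, bogIntegrand ℓ θ m f x p.1 p.2 ∂sliceMeasure n‖ₑ ^ 2
      ≤ ∫⁻ x, (∫⁻ p, bogKernel θ Ω x p * (ENNReal.ofReal R * ‖f p.2‖ₑ) ∂sliceMeasure n) ^ 2 := by
        refine lintegral_mono fun x =>
          pow_le_pow_left' ((enorm_integral_le_lintegral_enorm _).trans (lintegral_mono_ae ?_)) 2
        filter_upwards [ae_sliceMeasure_of_support hfΩ] with p hp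
        exact enorm_bogIntegrand_le hR hp.1 hp.2
    _ ≤ ENNReal.ofReal (2 ^ n) * ((∫⁻ z, ‖θ z‖ₑ) + volume Ω * ENNReal.ofReal B) *
          (∫⁻ z, ‖θ z‖ₑ) * ∫⁻ p, (ENNReal.ofReal R * ‖f p.2‖ₑ) ^ 2 ∂sliceMeasure n := by
        refine lintegral_lintegral_mul_sq_le_of_schur (measurable_bogKernel hθ hΩ)
          (hf.1.enorm.const_mul _).comp_snd
          (.of_forall fun x => lintegral_bogKernel_sliceMeasure_le hθ hΩ hB x) ?_
        filter_upwards [ae_sliceMeasure_of_support hfΩ] with p hp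
        exact lintegral_bogKernel_left_le θ Ω hp.1.1 p.2
    _ < ⊤ := by
        rw [lintegral_comp_snd_sliceMeasure (G := fun y => (ENNReal.ofReal R * ‖f y‖ₑ) ^ 2)
          ((hf.1.enorm.const_mul _).pow_const 2)]
        have θ_lt_top : ∫⁻ z, ‖θ z‖ₑ < ⊤ := integrable_θ.2
        finiteness

end Kernel

section WeakForm

variable {n ℓ : ℕ} {θ η f h ψ : EuclideanSpace ℝ (Fin n) → ℝ} {m : Fin n}
  {Ω : Set (EuclideanSpace ℝ (Fin n))} {R B : ℝ}

/-- The bilinear form `∫ h(y) ∫ η(z) ψ((1 - s) y + s z) dz dy`, two of which make up the slice at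
`s` of the pairing of `Q_ℓ f` with `ψ`. -/
noncomputable def slicePairing (η h ψ : EuclideanSpace ℝ (Fin n) → ℝ) (s : ℝ) : ℝ :=
  ∫ y, h y * ∫ z, η z * ψ ((1 - s) • y + s • z)

theorem enorm_slicePairing_le (hη : Integrable η) (hh : Integrable h) (hψ : ContDiff ℝ ∞ ψ)
    (hψc : HasCompactSupport ψ) (s : ℝ) :
    ‖slicePairing η h ψ s‖ₑ ≤
      fourierSlice (fun z => (η z : ℂ)) (fun y => (h y : ℂ)) (complexSchwartz ψ hψ hψc) s := by
  have ofReal_slicePairing : (slicePairing η h ψ s : ℂ) = ∫ y, (h y : ℂ) * ∫ z, (η z : ℂ) *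
      complexSchwartz ψ hψ hψc ((1 - s) • y + s • z) := by
    simp only [slicePairing, complexSchwartz_apply, ← Complex.ofReal_mul, integral_complex_ofReal]
  have enorm_ofReal : ‖slicePairing η h ψ s‖ₑ = ‖(slicePairing η h ψ s : ℂ)‖ₑ := by
    simp only [← ofReal_norm, Complex.norm_real]
  have integrable_h : Integrable fun y => (h y : ℂ) := hh.ofReal
  have integrable_η : Integrable fun z => (η z : ℂ) := hη.ofReal
  rw [enorm_ofReal, ofReal_slicePairing,
    integral_mul_integral_mul_comp_add_smul s (1 - s) integrable_h integrable_η]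
  refine (enorm_integral_le_lintegral_enorm _).trans_eq ?_
  simp only [enorm_mul, fourierSlice]

theorem integrable_mul_comp_convex_comb (hη : Integrable η) (hψ : Continuous ψ)
    (hB : ∀ x, ‖ψ x‖ ≤ B) (s : ℝ) (y : EuclideanSpace ℝ (Fin n)) :
    Integrable fun z => η z * ψ ((1 - s) • y + s • z) :=
  hη.mul_bdd (c := B) (Continuous.aestronglyMeasurable (by fun_prop)) (.of_forall fun _ => hB _)

theorem integrable_slicePairing (hη : Integrable η) (hh : Integrable h) (hψ : Continuous ψ)
    (hB : ∀ x, ‖ψ x‖ ≤ B) (s : ℝ) :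
    Integrable fun y => h y * ∫ z, η z * ψ ((1 - s) • y + s • z) := by
  have integrable_joint :
      Integrable (fun p : EuclideanSpace ℝ (Fin n) × EuclideanSpace ℝ (Fin n) =>
        (h p.1 * η p.2) * ψ ((1 - s) • p.1 + s • p.2)) (volume.prod volume) :=
    (hh.mul_prod hη).mul_bdd (c := B) (Continuous.aestronglyMeasurable (by fun_prop))
      (.of_forall fun _ => hB _)
  simpa only [mul_assoc, integral_const_mul] using integrable_joint.integral_prod_left

theorem integrable_coord_sub_mul (hθ : Continuous θ) (hc : HasCompactSupport θ) (m : Fin n)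
    (c : EuclideanSpace ℝ (Fin n)) : Integrable fun z => (z m - c m) * θ z :=
  Continuous.integrable_of_hasCompactSupport (by fun_prop) hc.mul_left

theorem integral_bogIntegrand_mul (hθ : Continuous θ) (hc : HasCompactSupport θ)
    (hψ : Continuous ψ) (hB : ∀ x, ‖ψ x‖ ≤ B) (c : EuclideanSpace ℝ (Fin n)) {s : ℝ} (hs : 0 < s)
    (y : EuclideanSpace ℝ (Fin n)) :
    ∫ x, bogIntegrand ℓ θ m f x s y * ψ x = (1 - s) ^ (n - ℓ) *
      ((f y * ∫ z, ((z m - c m) * θ z) * ψ ((1 - s) • y + s • z)) -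
        ((y m - c m) * f y) * ∫ z, θ z * ψ ((1 - s) • y + s • z)) := by
  have integrable_coord :=
    integrable_mul_comp_convex_comb (integrable_coord_sub_mul hθ hc m c) hψ hB s y
  have integrable_θ :=
    integrable_mul_comp_convex_comb (hθ.integrable_of_hasCompactSupport hc) hψ hB s y
  rw [integral_eq_integral_convex_comb _ y hs, ← integral_const_mul, ← integral_const_mul,
    ← integral_const_mul, ← integral_sub (integrable_coord.const_mul _)
      (integrable_θ.const_mul _), ← integral_const_mul]
  congr 1 with z
  rw [bogIntegrand_convex_comb hs]
  field_simp
  ring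

theorem integral_bogReduced_mul_eq (hθ : Continuous θ) (hc : HasCompactSupport θ)
    (hf : Integrable f) (hfΩ : ∀ᵐ y ∂volume, y ∉ Ω → f y = 0)
    (hR : ∀ z, θ z ≠ 0 → ∀ y ∈ Ω, |z m - y m| ≤ R) (c : EuclideanSpace ℝ (Fin n))
    (hcf : Integrable fun y => (y m - c m) * f y) (hψ : Continuous ψ) (hB : ∀ x, ‖ψ x‖ ≤ B) :
    ∫ x, bogReduced ℓ θ m f x * ψ x = ∫ s in Ioo (0 : ℝ) 1, (1 - s) ^ (n - ℓ) *
      (slicePairing (fun z => (z m - c m) * θ z) f ψ s -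
        slicePairing θ (fun y => (y m - c m) * f y) ψ s) := by
  have integrable_mul :
      Integrable (fun q : EuclideanSpace ℝ (Fin n) × (ℝ × EuclideanSpace ℝ (Fin n)) =>
        bogIntegrand ℓ θ m f q.1 q.2.1 q.2.2 * ψ q.1) (volume.prod (sliceMeasure n)) :=
    (integrable_bogIntegrand hθ hc hf hfΩ hR).mul_bdd (c := B)
      (Continuous.aestronglyMeasurable (by fun_prop)) (.of_forall fun _ => hB _)
  calc ∫ x, bogReduced ℓ θ m f x * ψ x
      = ∫ x, ∫ p, bogIntegrand ℓ θ m f x p.1 p.2 * ψ x ∂sliceMeasure n := by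
        refine integral_congr_ae ?_
        filter_upwards [bogReduced_ae_eq (ℓ := ℓ) hθ hc hf hfΩ hR] with x hx
        rw [hx, integral_mul_const]
    _ = ∫ p, (∫ x, bogIntegrand ℓ θ m f x p.1 p.2 * ψ x) ∂sliceMeasure n :=
        integral_integral_swap integrable_mul
    _ = ∫ s in Ioo (0 : ℝ) 1, ∫ y, ∫ x, bogIntegrand ℓ θ m f x s y * ψ x :=
        integral_prod _ integrable_mul.integral_prod_right
    _ = _ := by
        refine setIntegral_congr_fun measurableSet_Ioo fun s hs => ?_
        simp only [integral_bogIntegrand_mul hθ hc hψ hB c hs.1]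
        rw [integral_const_mul, integral_sub
          (integrable_slicePairing (integrable_coord_sub_mul hθ hc m c) hf hψ hB s)
          (integrable_slicePairing (hθ.integrable_of_hasCompactSupport hc) hcf hψ hB s)]
        rfl

theorem enorm_integral_bogReduced_mul_le (hθ : Continuous θ) (hc : HasCompactSupport θ)
    (hf : Integrable f) (hfΩ : ∀ᵐ y ∂volume, y ∉ Ω → f y = 0)
    (hR : ∀ z, θ z ≠ 0 → ∀ y ∈ Ω, |z m - y m| ≤ R) (c : EuclideanSpace ℝ (Fin n))
    (hcf : Integrable fun y => (y m - c m) * f y) (hψ : ContDiff ℝ ∞ ψ)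
    (hψc : HasCompactSupport ψ) :
    ‖∫ x, bogReduced ℓ θ m f x * ψ x‖ₑ ≤
      (∫⁻ s in Ioo (0 : ℝ) 1, ENNReal.ofReal ((1 - s) ^ (n - ℓ)) *
        fourierSlice (fun z => (((z m - c m) * θ z : ℝ) : ℂ)) (fun y => (f y : ℂ))
          (complexSchwartz ψ hψ hψc) s) +
      ∫⁻ s in Ioo (0 : ℝ) 1, ENNReal.ofReal ((1 - s) ^ (n - ℓ)) *
        fourierSlice (fun z => (θ z : ℂ)) (fun y => (((y m - c m) * f y : ℝ) : ℂ))
          (complexSchwartz ψ hψ hψc) s := by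
  have integrable_θ : Integrable θ := hθ.integrable_of_hasCompactSupport hc
  have integrable_coord := integrable_coord_sub_mul hθ hc m c
  obtain ⟨B, hB⟩ := hψ.continuous.bounded_above_of_compact_support hψc
  have measurable_weight : Measurable fun s : ℝ => ENNReal.ofReal ((1 - s) ^ (n - ℓ)) := by
    fun_prop
  have measurable_slice : Measurable fun s : ℝ => ENNReal.ofReal ((1 - s) ^ (n - ℓ)) *
      fourierSlice (fun z => (((z m - c m) * θ z : ℝ) : ℂ)) (fun y => (f y : ℂ))
        (complexSchwartz ψ hψ hψc) s :=
    measurable_weight.mul (measurable_fourierSlice integrable_coord.ofReal hf.ofReal _)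
  rw [integral_bogReduced_mul_eq hθ hc hf hfΩ hR c hcf hψ.continuous hB,
    ← lintegral_add_left measurable_slice]
  refine (enorm_integral_le_lintegral_enorm _).trans
    (setLIntegral_mono' measurableSet_Ioo fun s hs => ?_)
  rw [enorm_mul, Real.enorm_of_nonneg (pow_nonneg (by linarith [hs.2]) _), ← mul_add]
  gcongr
  exact enorm_sub_le.trans (add_le_add (enorm_slicePairing_le integrable_coord hf hψ hψc s)
    (enorm_slicePairing_le integrable_θ hcf hψ hψc s))

end WeakForm

section Duality

theorem exists_inner_eq_of_abs_le {T H : Type*} [AddCommGroup T] [Module ℝ T]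
    [NormedAddCommGroup H] [InnerProductSpace ℝ H] [CompleteSpace H] (ι : T →ₗ[ℝ] H)
    (Λ : T →ₗ[ℝ] ℝ) {M : ℝ} (hM : 0 ≤ M) (hΛ : ∀ t, |Λ t| ≤ M * ‖ι t‖) :
    ∃ g : H, ‖g‖ ≤ M ∧ ∀ t, Λ t = inner ℝ g (ι t) := by
  have ker_le : LinearMap.ker ι ≤ LinearMap.ker Λ := fun t ht => by
    simpa [LinearMap.mem_ker.1 ht] using hΛ t
  let Λ_range : LinearMap.range ι →ₗ[ℝ] ℝ :=
    ((LinearMap.ker ι).liftQ Λ ker_le).comp ι.quotKerEquivRange.symm.toLinearMap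
  have Λ_range_apply (t : T) : Λ_range ⟨ι t, LinearMap.mem_range_self ι t⟩ = Λ t := by
    have symm_apply : ι.quotKerEquivRange.symm ⟨ι t, LinearMap.mem_range_self ι t⟩ =
        (LinearMap.ker ι).mkQ t := by
      rw [LinearEquiv.symm_apply_eq]
      rfl
    simp [Λ_range, symm_apply]
  let Λ_dual : StrongDual ℝ (LinearMap.range ι) := Λ_range.mkContinuous M (by
    rintro ⟨_, t, rfl⟩
    rw [Λ_range_apply]
    exact hΛ t)
  obtain ⟨G, G_extends, norm_G⟩ := exists_extension_norm_eq (LinearMap.range ι) Λ_dual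
  refine ⟨(InnerProductSpace.toDual ℝ H).symm G, ?_, fun t => ?_⟩
  · rw [LinearIsometryEquiv.norm_map, norm_G]
    exact LinearMap.mkContinuous_norm_le _ hM _
  · rw [InnerProductSpace.toDual_symm_apply, ← Λ_range_apply]
    exact (G_extends ⟨ι t, LinearMap.mem_range_self ι t⟩).symm

theorem eLpNorm_two_eq_ofReal_sqrt {α : Type*} [MeasurableSpace α] {μ : Measure α} {f : α → ℝ}
    (hf : MemLp f 2 μ) : eLpNorm f 2 μ = ENNReal.ofReal (√(∫ x, f x ^ 2 ∂μ)) := by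
  have sq_eq : eLpNorm f 2 μ ^ 2 = ENNReal.ofReal (√(∫ x, f x ^ 2 ∂μ)) ^ 2 := by
    rw [eLpNorm_two_sq, ← ENNReal.ofReal_pow (by positivity),
      Real.sq_sqrt (integral_nonneg fun x => sq_nonneg _),
      ofReal_integral_eq_lintegral_ofReal hf.integrable_sq (.of_forall fun x => sq_nonneg _)]
    refine lintegral_congr fun x => ?_
    rw [← ofReal_norm, ← ENNReal.ofReal_pow (by positivity), Real.norm_eq_abs, sq_abs]
  exact (ENNReal.pow_right_strictMono two_ne_zero).injective sq_eq

variable {n : ℕ} {Ω : Set (EuclideanSpace ℝ (Fin n))} {u : EuclideanSpace ℝ (Fin n) → ℝ}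

/-- The space `C_c^∞(Ω)` of test functions, the domain of the functionals `φ ↦ ∫ u ∂_j φ` whose
`L²`-boundedness is the existence of weak derivatives. -/
def testSpace (Ω : Set (EuclideanSpace ℝ (Fin n))) :
    Submodule ℝ (EuclideanSpace ℝ (Fin n) → ℝ) where
  carrier := {φ | ContDiff ℝ ∞ φ ∧ HasCompactSupport φ ∧ tsupport φ ⊆ Ω}
  add_mem' := by
    rintro φ ψ ⟨φ_smooth, φ_compact, φ_subset⟩ ⟨ψ_smooth, ψ_compact, ψ_subset⟩
    exact ⟨φ_smooth.add ψ_smooth, φ_compact.add ψ_compact,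
      (tsupport_add φ ψ).trans (union_subset φ_subset ψ_subset)⟩
  zero_mem' := ⟨contDiff_const, HasCompactSupport.zero, by simp⟩
  smul_mem' := by
    rintro a φ ⟨φ_smooth, φ_compact, φ_subset⟩
    exact ⟨contDiff_const.smul φ_smooth, φ_compact.smul_left (f := fun _ => a),
      (tsupport_smul_subset_right (fun _ => a) φ).trans φ_subset⟩

namespace testSpace

theorem memLp (φ : testSpace Ω) : MemLp φ.1 2 (volume.restrict Ω) :=
  (φ.2.1.continuous.memLp_of_hasCompactSupport φ.2.2.1).restrict Ω

/-- The inclusion of `C_c^∞(Ω)` in `L²(Ω)`. -/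
noncomputable def toL2 (Ω : Set (EuclideanSpace ℝ (Fin n))) :
    testSpace Ω →ₗ[ℝ] Lp ℝ 2 (volume.restrict Ω) where
  toFun φ := (memLp φ).toLp φ.1
  map_add' φ ψ := MemLp.toLp_add (memLp φ) (memLp ψ)
  map_smul' a φ := MemLp.toLp_const_smul a (memLp φ)

theorem norm_toL2 (φ : testSpace Ω) : ‖toL2 Ω φ‖ = √(∫ x in Ω, φ.1 x ^ 2) := by
  change ‖(memLp φ).toLp φ.1‖ = _
  rw [Lp.norm_toLp, eLpNorm_two_eq_ofReal_sqrt (memLp φ), ENNReal.toReal_ofReal (by positivity)]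

theorem inner_toL2 (G : Lp ℝ 2 (volume.restrict Ω)) (φ : testSpace Ω) :
    inner ℝ G (toL2 Ω φ) = ∫ x in Ω, G x * φ.1 x := by
  rw [L2.inner_def]
  refine integral_congr_ae ?_
  filter_upwards [(memLp φ).coeFn_toLp] with x hx
  change inner ℝ (G x) ((memLp φ).toLp φ.1 x) = _
  rw [hx]
  simp [mul_comm]

theorem integrable_mul_partialDeriv (hu : MemLp u 2 (volume.restrict Ω)) (j : Fin n)
    (φ : testSpace Ω) : Integrable (fun x => u x * partialDeriv j φ.1 x) (volume.restrict Ω) :=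
  hu.integrable_mul (q := 2) (((contDiff_partialDeriv φ.2.1 j).continuous.memLp_of_hasCompactSupport
    (hasCompactSupport_partialDeriv φ.2.2.1 j)).restrict Ω)

/-- The functional `φ ↦ ∫_Ω u ∂_j φ`. -/
noncomputable def weakDeriv (hu : MemLp u 2 (volume.restrict Ω)) (j : Fin n) :
    testSpace Ω →ₗ[ℝ] ℝ where
  toFun φ := ∫ x in Ω, u x * partialDeriv j φ.1 x
  map_add' φ ψ := by
    rw [← integral_add (integrable_mul_partialDeriv hu j φ) (integrable_mul_partialDeriv hu j ψ)]
    congr 1 with x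
    have fderiv_eq := fderiv_add (φ.2.1.differentiable (by simp) x)
      (ψ.2.1.differentiable (by simp) x)
    simp [partialDeriv, fderiv_eq, mul_add]
  map_smul' a φ := by
    rw [RingHom.id_apply, smul_eq_mul, ← integral_const_mul]
    congr 1 with x
    have fderiv_eq := fderiv_const_smul (φ.2.1.differentiable (by simp) x) a
    simp [partialDeriv, fderiv_eq, mul_left_comm]

end testSpace

theorem exists_weak_partialDeriv (hu : MemLp u 2 (volume.restrict Ω)) (j : Fin n) {M : ℝ}
    (hM : 0 ≤ M)
    (u_bounded : ∀ φ : EuclideanSpace ℝ (Fin n) → ℝ, ContDiff ℝ ∞ φ → HasCompactSupport φ →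
      tsupport φ ⊆ Ω → |∫ x in Ω, u x * partialDeriv j φ x| ≤ M * √(∫ x in Ω, φ x ^ 2)) :
    ∃ g : EuclideanSpace ℝ (Fin n) → ℝ, MemLp g 2 (volume.restrict Ω) ∧
      ∫ x in Ω, g x ^ 2 ≤ M ^ 2 ∧
      ∀ φ : EuclideanSpace ℝ (Fin n) → ℝ, ContDiff ℝ ∞ φ → HasCompactSupport φ →
        tsupport φ ⊆ Ω → ∫ x in Ω, u x * partialDeriv j φ x = - ∫ x in Ω, g x * φ x := by
  obtain ⟨G, norm_G_le, weakDeriv_eq⟩ := exists_inner_eq_of_abs_le (testSpace.toL2 Ω)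
    (testSpace.weakDeriv hu j) hM fun φ =>
      (u_bounded φ.1 φ.2.1 φ.2.2.1 φ.2.2.2).trans_eq (by rw [testSpace.norm_toL2])
  refine ⟨fun x => -G x, (Lp.memLp G).neg, ?_, fun φ φ_smooth φ_compact φ_subset => ?_⟩
  · rw [Lp.norm_def, eLpNorm_two_eq_ofReal_sqrt (Lp.memLp G),
      ENNReal.toReal_ofReal (by positivity)] at norm_G_le
    simpa only [neg_sq] using (Real.sqrt_le_left hM).1 norm_G_le
  · simp only [neg_mul, integral_neg, neg_neg]
    exact (weakDeriv_eq ⟨φ, φ_smooth, φ_compact, φ_subset⟩).trans (testSpace.inner_toL2 G _)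

end Duality

section Geometry

variable {n : ℕ} {Ω : Set (EuclideanSpace ℝ (Fin n))} {c : EuclideanSpace ℝ (Fin n)} {r : ℝ}

namespace IsBoundedDomainStarShapedBall

theorem homothety_mem (hΩ : IsBoundedDomainStarShapedBall Ω c r) {y : EuclideanSpace ℝ (Fin n)}
    (hy : y ∈ closure Ω) {μ : ℝ} (hμ : 0 < μ) (hμ1 : μ < 1) :
    AffineMap.homothety c μ y ∈ Ω := by
  have r_pos := hΩ.radius_pos
  have one_sub_pos : 0 < 1 - μ := by linarith
  obtain ⟨w, hw, dist_lt⟩ := Metric.mem_closure_iff.1 hy (r * (1 - μ) / μ) (by positivity)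
  -- Chosen so that the homothetic image of `y` is `μ • w + (1 - μ) • b`.
  set b := c + (μ / (1 - μ)) • (y - w) with b_def
  have b_mem : b ∈ Metric.ball c r := by
    rw [mem_ball_iff_norm, b_def, add_sub_cancel_left, norm_smul,
      Real.norm_of_nonneg (by positivity), ← dist_eq_norm]
    calc μ / (1 - μ) * dist y w < μ / (1 - μ) * (r * (1 - μ) / μ) := by gcongr
      _ = r := by field_simp
  refine hΩ.convexHull_subset w hw ?_
  have convex_comb_mem := convex_convexHull ℝ (Metric.ball c r ∪ {w})
    (subset_convexHull ℝ _ (Or.inr rfl : w ∈ Metric.ball c r ∪ {w}))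
    (subset_convexHull ℝ _ (Or.inl b_mem)) hμ.le one_sub_pos.le (by ring)
  convert convex_comb_mem using 1
  rw [AffineMap.homothety_apply, b_def, smul_add, smul_smul, mul_div_cancel₀ _ one_sub_pos.ne']
  simp only [vsub_eq_sub, vadd_eq_add]
  module

theorem volume_closure_le (hΩ : IsBoundedDomainStarShapedBall Ω c r) :
    volume (closure Ω) ≤ volume Ω := by
  have contracted_le : ∀ μ ∈ Ioo (0 : ℝ) 1,
      ENNReal.ofReal (μ ^ n) * volume (closure Ω) ≤ volume Ω := fun μ hμ => by
    have volume_image := Measure.addHaar_image_homothety volume c μ (closure Ω)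
    rw [finrank_euclideanSpace_fin, abs_of_pos (pow_pos hμ.1 n)] at volume_image
    rw [← volume_image]
    exact measure_mono (image_subset_iff.2 fun y hy => hΩ.homothety_mem hy hμ.1 hμ.2)
  have continuous_contracted : Continuous fun μ : ℝ =>
      ENNReal.ofReal (μ ^ n) * volume (closure Ω) :=
    (ENNReal.continuous_mul_const hΩ.isBounded.closure.measure_lt_top.ne).comp
      (ENNReal.continuous_ofReal.comp (continuous_pow n))
  have tendsto_volume := (continuous_contracted.tendsto 1).mono_left
    (nhdsWithin_le_nhds (s := Iio 1))
  rw [one_pow, ENNReal.ofReal_one, one_mul] at tendsto_volume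
  refine le_of_tendsto tendsto_volume ?_
  filter_upwards [Ioo_mem_nhdsLT (zero_lt_one' ℝ)] with μ hμ using contracted_le μ hμ

theorem ae_eq_zero_of_notMem (hΩ : IsBoundedDomainStarShapedBall Ω c r)
    {f : EuclideanSpace ℝ (Fin n) → ℝ} (hf : ∀ᵐ x ∂volume, x ∉ closure Ω → f x = 0) :
    ∀ᵐ x ∂volume, x ∉ Ω → f x = 0 := by
  have volume_sdiff : volume (closure Ω \ Ω) = 0 := by
    rw [measure_sdiff subset_closure hΩ.isOpen.measurableSet.nullMeasurableSet
      hΩ.isBounded.measure_lt_top.ne]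
    exact tsub_eq_zero_of_le hΩ.volume_closure_le
  filter_upwards [hf, measure_eq_zero_iff_ae_notMem.1 volume_sdiff] with x hx x_notMem hxΩ
  exact hx fun x_mem => x_notMem ⟨x_mem, hxΩ⟩

end IsBoundedDomainStarShapedBall

theorem volume_real_ball_eq (c : EuclideanSpace ℝ (Fin n)) (hr : 0 < r) :
    volume.real (Metric.ball c r) =
      (volume.real (Metric.ball (0 : EuclideanSpace ℝ (Fin n)) 1) / 2 ^ n) * (2 * r) ^ n := by
  rw [measureReal_def, Measure.addHaar_ball_of_pos volume c hr, finrank_euclideanSpace_fin,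
    ENNReal.toReal_mul, ENNReal.toReal_ofReal (by positivity), measureReal_def, mul_pow]
  field_simp

end Geometry

section Support

variable {α F : Type*} [MeasurableSpace α] {μ : Measure α} [NormedAddCommGroup F] {h : α → F}
  {Ω : Set α}

theorem sq_lintegral_enorm_le_of_support (hh : AEStronglyMeasurable h μ) (hΩ : MeasurableSet Ω)
    (hhΩ : ∀ᵐ x ∂μ, x ∉ Ω → h x = 0) :
    (∫⁻ x, ‖h x‖ₑ ∂μ) ^ 2 ≤ μ Ω * eLpNorm h 2 μ ^ 2 := by
  calc (∫⁻ x, ‖h x‖ₑ ∂μ) ^ 2 = (∫⁻ x, Ω.indicator 1 x * ‖h x‖ₑ ∂μ) ^ 2 := by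
        congr 1
        refine lintegral_congr_ae ?_
        filter_upwards [hhΩ] with x hx
        by_cases hxΩ : x ∈ Ω
        · simp [indicator_of_mem hxΩ]
        · simp [hx hxΩ]
    _ ≤ (∫⁻ x, Ω.indicator 1 x ^ 2 ∂μ) * ∫⁻ x, ‖h x‖ₑ ^ 2 ∂μ :=
        lintegral_mul_sq_le (measurable_one.indicator hΩ).aemeasurable hh.enorm
    _ = μ Ω * eLpNorm h 2 μ ^ 2 := by
        have indicator_sq : ∀ x, (Ω.indicator (1 : α → ℝ≥0∞) x) ^ 2 = Ω.indicator 1 x :=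
          fun x => by by_cases hx : x ∈ Ω <;> simp [hx]
        simp only [eLpNorm_two_sq, indicator_sq, lintegral_indicator_one hΩ]

theorem integrable_of_memLp_two_of_support (hh : MemLp h 2 μ) (hΩ_fin : μ Ω ≠ ⊤)
    (hhΩ : ∀ᵐ x ∂μ, x ∉ Ω → h x = 0) : Integrable h μ := by
  have : IsFiniteMeasure (μ.restrict Ω) := ⟨by simpa using hΩ_fin.lt_top⟩
  exact IntegrableOn.integrable_of_ae_notMem_eq_zero
    ((hh.restrict Ω).integrable one_le_two) hhΩ

end Support

section RegularizingKernel

variable {n : ℕ} {K : (Fin n → ℕ) → ℝ} {c : EuclideanSpace ℝ (Fin n)} {r : ℝ}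
  {θ : EuclideanSpace ℝ (Fin n) → ℝ}

theorem foldr_partialDeriv_single (θ : EuclideanSpace ℝ (Fin n) → ℝ) (j : Fin n) (k : ℕ) :
    ∀ L : List (Fin n), L.Nodup →
      L.foldr (fun i v => (partialDeriv i)^[(Pi.single j k : Fin n → ℕ) i] v) θ =
        if j ∈ L then (partialDeriv j)^[k] θ else θ
  | [], _ => by simp
  | i :: L, nodup => by
    rw [List.nodup_cons] at nodup
    rw [List.foldr_cons, foldr_partialDeriv_single θ j k L nodup.2]
    by_cases hij : i = j
    · subst hij
      simp [nodup.1]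
    · simp [Ne.symm hij]

theorem multiDeriv_single (θ : EuclideanSpace ℝ (Fin n) → ℝ) (j : Fin n) (k : ℕ) :
    multiDeriv (Pi.single j k) θ = (partialDeriv j)^[k] θ := by
  rw [multiDeriv, foldr_partialDeriv_single θ j k _ (List.nodup_finRange n)]
  simp

/-- The constant through which the family `K` enters the estimates. Only multi-indices with all
entries at most two matter; the summand `1` makes it positive. -/
noncomputable def kernelConstant (K : (Fin n → ℕ) → ℝ) : ℝ :=
  1 + ∑ α ∈ Fintype.piFinset fun _ => Finset.range 3, |K α|

theorem kernelConstant_pos (K : (Fin n → ℕ) → ℝ) : 0 < kernelConstant K := by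
  unfold kernelConstant
  positivity

theorem le_kernelConstant (K : (Fin n → ℕ) → ℝ) {α : Fin n → ℕ} (hα : ∀ i, α i ≤ 2) :
    K α ≤ kernelConstant K := by
  have α_mem : α ∈ Fintype.piFinset fun _ => Finset.range 3 :=
    Fintype.mem_piFinset.2 fun i => Finset.mem_range_succ_iff.2 (hα i)
  have abs_le_sum := Finset.single_le_sum (f := fun α => |K α|) (fun _ _ => abs_nonneg _) α_mem
  unfold kernelConstant
  linarith [le_abs_self (K α)]

theorem single_apply_le (j i : Fin n) (k : ℕ) : (Pi.single j k : Fin n → ℕ) i ≤ k := by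
  rw [Pi.single_apply]
  split_ifs <;> simp

namespace IsRegularizingKernel

theorem integral_abs_iterate_partialDeriv_le (hθ : IsRegularizingKernel K c r θ) (j : Fin n)
    {k : ℕ} (hk : k ≤ 2) :
    ∫ x, |(partialDeriv j)^[k] θ x| ≤
      kernelConstant K / Metric.diam (Metric.ball c r) ^ k := by
  have integral_le := hθ.integral_abs_le (Pi.single j k)
  rw [multiDeriv_single, Finset.sum_pi_single', if_pos (Finset.mem_univ j)] at integral_le
  refine integral_le.trans ?_
  gcongr
  exact le_kernelConstant K fun i => (single_apply_le j i k).trans hk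

theorem abs_iterate_partialDeriv_le (hθ : IsRegularizingKernel K c r θ) (j : Fin n)
    {k : ℕ} (hk : k ≤ 2) (x : EuclideanSpace ℝ (Fin n)) :
    |(partialDeriv j)^[k] θ x| ≤
      kernelConstant K / Metric.diam (Metric.ball c r) ^ (n + k) := by
  have abs_le := hθ.abs_le (Pi.single j k) x
  rw [multiDeriv_single, Finset.sum_pi_single', if_pos (Finset.mem_univ j)] at abs_le
  refine abs_le.trans ?_
  gcongr
  exact le_kernelConstant K fun i => (single_apply_le j i k).trans hk

theorem isBump [Nonempty (Fin n)] (hθ : IsRegularizingKernel K c r θ) (hr : 0 ≤ r) :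
    IsBump (kernelConstant K) c (Metric.diam (Metric.ball c r)) θ where
  contDiff := hθ.contDiff
  tsupport_subset := hθ.tsupport_subset.trans <| Metric.closedBall_subset_closedBall <| by
    rw [Metric.diam_ball_eq c hr]
    linarith
  integral_abs_le := by
    simpa using hθ.integral_abs_iterate_partialDeriv_le (Classical.arbitrary _) zero_le_two
  integral_abs_deriv_le j := by
    simpa using hθ.integral_abs_iterate_partialDeriv_le j one_le_two
  integral_abs_deriv_deriv_le j := hθ.integral_abs_iterate_partialDeriv_le j le_rfl
  abs_le := hθ.abs_iterate_partialDeriv_le (Classical.arbitrary _) zero_le_two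
  abs_deriv_le j := hθ.abs_iterate_partialDeriv_le j one_le_two

end IsRegularizingKernel

end RegularizingKernel

section Main

variable {n : ℕ} {Ω : Set (EuclideanSpace ℝ (Fin n))} {c : EuclideanSpace ℝ (Fin n)} {r : ℝ}
  {f : EuclideanSpace ℝ (Fin n) → ℝ}

theorem volume_real_ball_pos (c : EuclideanSpace ℝ (Fin n)) (hr : 0 < r) :
    0 < volume.real (Metric.ball c r) :=
  ENNReal.toReal_pos (Metric.measure_ball_pos volume c hr).ne' measure_ball_lt_top.ne

theorem one_le_volume_real_div_volume_real_ball (hΩ : Bornology.IsBounded Ω) (hr : 0 < r)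
    (hB : Metric.ball c r ⊆ Ω) : 1 ≤ volume.real Ω / volume.real (Metric.ball c r) :=
  (one_le_div (volume_real_ball_pos c hr)).2 (measureReal_mono hB hΩ.measure_lt_top.ne)

theorem sq_lintegral_enorm_ofReal_le (hΩ : MeasurableSet Ω) (hΩb : Bornology.IsBounded Ω)
    (hr : 0 < r) (hf : AEStronglyMeasurable f volume) (hfΩ : ∀ᵐ x ∂volume, x ∉ Ω → f x = 0) :
    (∫⁻ x, ‖(f x : ℂ)‖ₑ) ^ 2 ≤
      ENNReal.ofReal (volume.real Ω / volume.real (Metric.ball c r) *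
        (volume.real (Metric.ball (0 : EuclideanSpace ℝ (Fin n)) 1) / 2 ^ n * (2 * r) ^ n)) *
          eLpNorm (fun x => (f x : ℂ)) 2 volume ^ 2 := by
  rw [← volume_real_ball_eq c hr, div_mul_cancel₀ _ (volume_real_ball_pos c hr).ne',
    ofReal_measureReal hΩb.measure_lt_top.ne]
  refine sq_lintegral_enorm_le_of_support
    (Complex.continuous_ofReal.comp_aestronglyMeasurable hf) hΩ ?_
  filter_upwards [hfΩ] with x hx hxΩ
  rw [hx hxΩ, Complex.ofReal_zero]

theorem eLpNorm_complex_ofReal {α : Type*} [MeasurableSpace α] (p : ℝ≥0∞) (μ : Measure α)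
    (f : α → ℝ) : eLpNorm (fun x => (f x : ℂ)) p μ = eLpNorm f p μ :=
  eLpNorm_congr_norm_ae (.of_forall fun x => Complex.norm_real (f x))

theorem norm_coord_sub_mul_le_diam_mul (hΩ : Bornology.IsBounded Ω) (hc : c ∈ Ω)
    (hfΩ : ∀ᵐ x ∂volume, x ∉ Ω → f x = 0) (m : Fin n) :
    ∀ᵐ y ∂volume, ‖(y m - c m) * f y‖ ≤ Metric.diam Ω * ‖f y‖ := by
  filter_upwards [hfΩ] with y hy
  by_cases hyΩ : y ∈ Ω
  · rw [norm_mul]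
    gcongr
    exact (abs_coord_sub_coord_le y c m).trans (Metric.dist_le_diam_of_mem hΩ hyΩ hc)
  · simp [hy hyΩ]

theorem memLp_coord_sub_mul (hΩ : Bornology.IsBounded Ω) (hc : c ∈ Ω) (hf : MemLp f 2 volume)
    (hfΩ : ∀ᵐ x ∂volume, x ∉ Ω → f x = 0) (m : Fin n) :
    MemLp (fun y => (y m - c m) * f y) 2 volume :=
  hf.of_le_mul ((Continuous.aestronglyMeasurable (by fun_prop)).mul hf.1)
    (norm_coord_sub_mul_le_diam_mul hΩ hc hfΩ m)

theorem coord_sub_mul_ae_eq_zero (hfΩ : ∀ᵐ x ∂volume, x ∉ Ω → f x = 0) (m : Fin n) (a : ℝ) :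
    ∀ᵐ y ∂volume, y ∉ Ω → (y m - a) * f y = 0 := by
  filter_upwards [hfΩ] with y hy hyΩ
  rw [hy hyΩ, mul_zero]

theorem IsBump.abs_coord_sub_coord_le_add_diam {A ρ : ℝ} {θ : EuclideanSpace ℝ (Fin n) → ℝ}
    (hθ : IsBump A c ρ θ) (hΩ : Bornology.IsBounded Ω) (hc : c ∈ Ω) (m : Fin n) :
    ∀ z, θ z ≠ 0 → ∀ y ∈ Ω, |z m - y m| ≤ ρ + Metric.diam Ω := fun z hz y hy =>
  calc |z m - y m| ≤ dist z y := abs_coord_sub_coord_le z y m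
    _ ≤ dist z c + dist c y := dist_triangle z c y
    _ ≤ ρ + Metric.diam Ω :=
        add_le_add (hθ.tsupport_subset (subset_tsupport θ hz)) (Metric.dist_le_diam_of_mem hΩ hc hy)

theorem IsBump.enorm_integral_bogReduced_mul_le {ℓ : ℕ} {A ρ : ℝ}
    {θ ψ : EuclideanSpace ℝ (Fin n) → ℝ} (hθ : IsBump A c ρ θ) (hΩ : Bornology.IsBounded Ω)
    (hc : c ∈ Ω) (hf : MemLp f 2 volume) (hfΩ : ∀ᵐ x ∂volume, x ∉ Ω → f x = 0) (m : Fin n)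
    (hψ : ContDiff ℝ ∞ ψ) (hψc : HasCompactSupport ψ) :
    ‖∫ x, bogReduced ℓ θ m f x * ψ x‖ₑ ≤
      (∫⁻ s in Ioo (0 : ℝ) 1, ENNReal.ofReal ((1 - s) ^ (n - ℓ)) *
        fourierSlice (fun z => (((z m - c m) * θ z : ℝ) : ℂ)) (fun y => (f y : ℂ))
          (complexSchwartz ψ hψ hψc) s) +
      ∫⁻ s in Ioo (0 : ℝ) 1, ENNReal.ofReal ((1 - s) ^ (n - ℓ)) *
        fourierSlice (fun z => (θ z : ℂ)) (fun y => (((y m - c m) * f y : ℝ) : ℂ))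
          (complexSchwartz ψ hψ hψc) s :=
  _root_.enorm_integral_bogReduced_mul_le hθ.contDiff.continuous hθ.hasCompactSupport
    (integrable_of_memLp_two_of_support hf hΩ.measure_lt_top.ne hfΩ) hfΩ
    (hθ.abs_coord_sub_coord_le_add_diam hΩ hc m) c
    (integrable_of_memLp_two_of_support (memLp_coord_sub_mul hΩ hc hf hfΩ m)
      hΩ.measure_lt_top.ne (coord_sub_mul_ae_eq_zero hfΩ m (c m))) hψ hψc

theorem exists_lintegral_fourierSlice_ofReal_le {ℓ : ℕ} (hℓn : ℓ ≤ n) :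
    ∃ C : ℝ, 0 < C ∧ ∀ {A r : ℝ} {Ω : Set (EuclideanSpace ℝ (Fin n))}
      {c : EuclideanSpace ℝ (Fin n)} {η h φ : EuclideanSpace ℝ (Fin n) → ℝ} (j : Fin n)
      (hφ : ContDiff ℝ ∞ φ) (hφc : HasCompactSupport φ),
      MeasurableSet Ω → Bornology.IsBounded Ω → 0 < r → Metric.ball c r ⊆ Ω →
      IsBump A c (2 * r) η → MemLp h 2 volume → (∀ᵐ x ∂volume, x ∉ Ω → h x = 0) →
      ∫⁻ s in Ioo (0 : ℝ) 1, ENNReal.ofReal ((1 - s) ^ (n - ℓ)) *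
          fourierSlice (fun z => (η z : ℂ)) (fun y => (h y : ℂ))
            (complexSchwartz (partialDeriv j φ) (contDiff_partialDeriv hφ j)
              (hasCompactSupport_partialDeriv hφc j)) s ≤
        ENNReal.ofReal (C * (A / (2 * r)) *
          bogKappa n ℓ (volume.real Ω / volume.real (Metric.ball c r))) *
            (eLpNorm h 2 volume * eLpNorm φ 2 volume) := by
  obtain ⟨C, C_pos, slice_le⟩ := exists_lintegral_fourierSlice_le hℓn
    (b := volume.real (Metric.ball (0 : EuclideanSpace ℝ (Fin n)) 1) / 2 ^ n) (by positivity)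
  refine ⟨C, C_pos, ?_⟩
  intro A r Ω c η h φ j hφ hφc hΩ hΩb hr hB hη hh hhΩ
  have h_integrable := integrable_of_memLp_two_of_support hh hΩb.measure_lt_top.ne hhΩ
  have h_slice_le := slice_le hη (complexSchwartz φ hφ hφc) j (by positivity)
    (one_le_volume_real_div_volume_real_ball hΩb hr hB) h_integrable.ofReal hh.ofReal
    (sq_lintegral_enorm_ofReal_le hΩ hΩb hr hh.1 hhΩ)
  rw [lineDeriv_complexSchwartz] at h_slice_le
  refine h_slice_le.trans_eq ?_
  rw [← eLpNorm_complex_ofReal 2 volume h, ← eLpNorm_complex_ofReal 2 volume φ]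
  rfl

theorem exists_enorm_integral_bogReduced_mul_partialDeriv_le {ℓ : ℕ} (hℓn : ℓ ≤ n) :
    ∃ C : ℝ, 0 < C ∧ ∀ {A r : ℝ} {Ω : Set (EuclideanSpace ℝ (Fin n))}
      {c : EuclideanSpace ℝ (Fin n)} {θ f φ : EuclideanSpace ℝ (Fin n) → ℝ} (m j : Fin n),
      MeasurableSet Ω → Bornology.IsBounded Ω → 0 < r → Metric.ball c r ⊆ Ω →
      IsBump A c (Metric.diam (Metric.ball c r)) θ → MemLp f 2 volume →
      (∀ᵐ x ∂volume, x ∉ Ω → f x = 0) → ContDiff ℝ ∞ φ → HasCompactSupport φ →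
      ‖∫ x, bogReduced ℓ θ m f x * partialDeriv j φ x‖ₑ ≤
        ENNReal.ofReal (C * A * (Metric.diam Ω / Metric.diam (Metric.ball c r)) *
          bogKappa n ℓ (volume.real Ω / volume.real (Metric.ball c r))) *
            (eLpNorm f 2 volume * eLpNorm φ 2 volume) := by
  obtain ⟨C, C_pos, slice_le⟩ := exists_lintegral_fourierSlice_ofReal_le hℓn
  refine ⟨4 * C, by positivity, ?_⟩
  intro A r Ω c θ f φ m j hΩ hΩb hr hB hθ hf hfΩ hφ hφc
  have : Nonempty (Fin n) := ⟨m⟩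
  have diam_ball_le : Metric.diam (Metric.ball c r) ≤ Metric.diam Ω := Metric.diam_mono hB hΩb
  rw [Metric.diam_ball_eq c hr.le] at hθ diam_ball_le ⊢
  have A_nonneg := hθ.nonneg
  have ρ_pos : 0 < 2 * r := by positivity
  have c_mem : c ∈ Ω := hB (Metric.mem_ball_self hr)
  have moment_memLp := memLp_coord_sub_mul hΩb c_mem hf hfΩ m
  have moment_support := coord_sub_mul_ae_eq_zero hfΩ m (c m)
  have moment_eLpNorm_le := eLpNorm_le_mul_eLpNorm_of_ae_le_mul
    (norm_coord_sub_mul_le_diam_mul hΩb c_mem hfΩ m) 2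
  have kernel_moment_le := slice_le j hφ hφc hΩ hΩb hr hB (hθ.coord_sub_mul ρ_pos m) hf hfΩ
  have data_moment_le := slice_le j hφ hφc hΩ hΩb hr hB hθ moment_memLp moment_support
  set κ := bogKappa n ℓ (volume.real Ω / volume.real (Metric.ball c r))
  have κ_nonneg : 0 ≤ κ :=
    zero_le_one.trans (one_le_bogKappa (one_le_volume_real_div_volume_real_ball hΩb hr hB))
  rw [mul_div_cancel_right₀ (3 * A) ρ_pos.ne'] at kernel_moment_le
  refine (hθ.enorm_integral_bogReduced_mul_le hΩb c_mem hf hfΩ m (contDiff_partialDeriv hφ j)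
    (hasCompactSupport_partialDeriv hφc j)).trans ?_
  calc _ ≤ ENNReal.ofReal (C * (3 * A) * κ) * (eLpNorm f 2 volume * eLpNorm φ 2 volume) +
          ENNReal.ofReal (C * (A / (2 * r)) * κ) *
            (ENNReal.ofReal (Metric.diam Ω) * eLpNorm f 2 volume * eLpNorm φ 2 volume) :=
        add_le_add kernel_moment_le (data_moment_le.trans (by gcongr))
    _ = ENNReal.ofReal (C * (3 * A) * κ + C * (A / (2 * r)) * κ * Metric.diam Ω) *
          (eLpNorm f 2 volume * eLpNorm φ 2 volume) := by
        rw [ENNReal.ofReal_add (by positivity) (by positivity),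
          ENNReal.ofReal_mul (q := Metric.diam Ω) (by positivity)]
        ring
    _ ≤ _ := by
        gcongr ENNReal.ofReal ?_ * _
        linear_combination (C * (3 * A) * κ) * (one_le_div ρ_pos).2 diam_ball_le

theorem exists_abs_integral_bogReduced_mul_partialDeriv_le {ℓ : ℕ} (hℓn : ℓ ≤ n) :
    ∃ C : ℝ, 0 < C ∧ ∀ {A r : ℝ} {Ω : Set (EuclideanSpace ℝ (Fin n))}
      {c : EuclideanSpace ℝ (Fin n)} {θ f φ : EuclideanSpace ℝ (Fin n) → ℝ} (m j : Fin n),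
      MeasurableSet Ω → Bornology.IsBounded Ω → 0 < r → Metric.ball c r ⊆ Ω →
      IsBump A c (Metric.diam (Metric.ball c r)) θ → MemLp f 2 volume →
      (∀ᵐ x ∂volume, x ∉ Ω → f x = 0) → ContDiff ℝ ∞ φ → HasCompactSupport φ →
      |∫ x, bogReduced ℓ θ m f x * partialDeriv j φ x| ≤
        C * A * (Metric.diam Ω / Metric.diam (Metric.ball c r)) *
          bogKappa n ℓ (volume.real Ω / volume.real (Metric.ball c r)) *
            √(∫ x, f x ^ 2) * √(∫ x, φ x ^ 2) := by
  obtain ⟨C, C_pos, enorm_le⟩ := exists_enorm_integral_bogReduced_mul_partialDeriv_le hℓn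
  refine ⟨C, C_pos, fun {A r Ω c θ f φ} m j hΩ hΩb hr hB hθ hf hfΩ hφ hφc => ?_⟩
  have A_nonneg := hθ.nonneg
  have κ_nonneg := zero_le_one.trans
    (one_le_bogKappa (n := n) (ℓ := ℓ) (one_le_volume_real_div_volume_real_ball hΩb hr hB))
  have norm_le := enorm_le m j hΩ hΩb hr hB hθ hf hfΩ hφ hφc
  rw [eLpNorm_two_eq_ofReal_sqrt hf,
    eLpNorm_two_eq_ofReal_sqrt (hφ.continuous.memLp_of_hasCompactSupport hφc),
    ← ENNReal.ofReal_mul (by positivity), ← ENNReal.ofReal_mul (by positivity), ← mul_assoc,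
    ← ofReal_norm, ENNReal.ofReal_le_ofReal_iff (by positivity)] at norm_le
  exact norm_le

theorem HasL2WeakGradient.mono {Ω' : Set (EuclideanSpace ℝ (Fin n))}
    {u : EuclideanSpace ℝ (Fin n) → ℝ} {g : Fin n → EuclideanSpace ℝ (Fin n) → ℝ}
    (hg : HasL2WeakGradient Ω' u g) (hΩ' : MeasurableSet Ω') (hΩ : Ω ⊆ Ω') :
    HasL2WeakGradient Ω u g where
  memLp := hg.memLp.mono_measure (Measure.restrict_mono_set _ hΩ)
  memLp_grad j := (hg.memLp_grad j).mono_measure (Measure.restrict_mono_set _ hΩ)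
  integral_eq j φ hφ hφc φ_subset := by
    have φ_eq_zero : ∀ x ∈ Ω' \ Ω, φ x = 0 := fun x hx =>
      image_eq_zero_of_notMem_tsupport fun x_mem => hx.2 (φ_subset x_mem)
    have deriv_eq_zero : ∀ x ∈ Ω' \ Ω, partialDeriv j φ x = 0 := fun x hx =>
      image_eq_zero_of_notMem_tsupport fun x_mem =>
        hx.2 (φ_subset (tsupport_partialDeriv_subset φ j x_mem))
    rw [← setIntegral_eq_of_subset_of_forall_sdiff_eq_zero hΩ' hΩ
        fun x hx => by rw [deriv_eq_zero x hx, mul_zero],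
      ← setIntegral_eq_of_subset_of_forall_sdiff_eq_zero hΩ' hΩ
        fun x hx => by rw [φ_eq_zero x hx, mul_zero]]
    exact hg.integral_eq j φ hφ hφc (φ_subset.trans hΩ)

theorem exists_hasL2WeakGradient_univ {u : EuclideanSpace ℝ (Fin n) → ℝ} {M : ℝ}
    (hu : MemLp u 2 volume) (hM : 0 ≤ M)
    (u_bounded : ∀ j φ, ContDiff ℝ ∞ φ → HasCompactSupport φ →
      |∫ x, u x * partialDeriv j φ x| ≤ M * √(∫ x, φ x ^ 2)) :
    ∃ g : Fin n → EuclideanSpace ℝ (Fin n) → ℝ, HasL2WeakGradient univ u g ∧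
      √(∑ j, ∫ x, g j x ^ 2) ≤ √n * M := by
  have hu_univ : MemLp u 2 (volume.restrict univ) := by rwa [Measure.restrict_univ]
  choose g g_memLp g_le integral_eq using fun j => exists_weak_partialDeriv hu_univ j hM
    fun φ hφ hφc _ => by simpa only [Measure.restrict_univ] using u_bounded j φ hφ hφc
  refine ⟨g, ⟨hu_univ, g_memLp, integral_eq⟩, ?_⟩
  simp only [Measure.restrict_univ] at g_le
  calc √(∑ j, ∫ x, g j x ^ 2) ≤ √(∑ _j : Fin n, M ^ 2) := by
        gcongr with j
        exact g_le j
    _ = √n * M := by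
        rw [Finset.sum_const, Finset.card_univ, Fintype.card_fin, nsmul_eq_mul,
          Real.sqrt_mul n.cast_nonneg, Real.sqrt_sq hM]

theorem HasL2WeakGradient.sqrt_sum_setIntegral_sq_le {u : EuclideanSpace ℝ (Fin n) → ℝ}
    {g : Fin n → EuclideanSpace ℝ (Fin n) → ℝ} (hg : HasL2WeakGradient univ u g)
    (Ω : Set (EuclideanSpace ℝ (Fin n))) :
    √(∑ j, ∫ x in Ω, g j x ^ 2) ≤ √(∑ j, ∫ x, g j x ^ 2) := by
  refine Real.sqrt_le_sqrt (Finset.sum_le_sum fun j _ => ?_)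
  have memLp_grad := hg.memLp_grad j
  rw [Measure.restrict_univ] at memLp_grad
  exact setIntegral_le_integral memLp_grad.integrable_sq (.of_forall fun x => sq_nonneg _)

end Main

theorem mainTheorem8_general (n ℓ : ℕ) (hℓn : ℓ ≤ n) :
    ∃ C : ℝ, 0 < C ∧
      ∀ (A : ℝ) (Ω : Set (EuclideanSpace ℝ (Fin n))) (c : EuclideanSpace ℝ (Fin n)) (r : ℝ),
        MeasurableSet Ω → Bornology.IsBounded Ω → 0 < r → Metric.ball c r ⊆ Ω →
      ∀ θ : EuclideanSpace ℝ (Fin n) → ℝ, IsBump A c (Metric.diam (Metric.ball c r)) θ →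
      ∀ (m : Fin n) (f : EuclideanSpace ℝ (Fin n) → ℝ),
        MemLp f 2 volume → (∀ᵐ x ∂volume, x ∉ Ω → f x = 0) →
        (∀ᵐ x ∂volume, Integrable
          (fun p : ℝ × EuclideanSpace ℝ (Fin n) => bogIntegrand ℓ θ m f x p.1 p.2)
          ((volume.restrict (Ioo (0 : ℝ) 1)).prod volume)) ∧
        ∃ g : Fin n → EuclideanSpace ℝ (Fin n) → ℝ,
          HasL2WeakGradient univ (bogReduced ℓ θ m f) g ∧
          √(∑ j, ∫ x, g j x ^ 2) ≤
            C * A * (Metric.diam Ω / Metric.diam (Metric.ball c r)) *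
              bogKappa n ℓ (volume.real Ω / volume.real (Metric.ball c r)) *
              √(∫ x, f x ^ 2) := by
  obtain ⟨C, C_pos, weak_bound⟩ := exists_abs_integral_bogReduced_mul_partialDeriv_le hℓn
  refine ⟨(√n + 1) * C, by positivity, fun A Ω c r hΩ hΩb hr hB θ hθ m f hf hfΩ => ?_⟩
  have θ_continuous := hθ.contDiff.continuous
  have f_integrable := integrable_of_memLp_two_of_support hf hΩb.measure_lt_top.ne hfΩ
  have coord_le := hθ.abs_coord_sub_coord_le_add_diam hΩb (hB (Metric.mem_ball_self hr)) m
  refine ⟨(integrable_bogIntegrand θ_continuous hθ.hasCompactSupport f_integrable hfΩ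
    coord_le).prod_right_ae, ?_⟩
  set M := C * A * (Metric.diam Ω / Metric.diam (Metric.ball c r)) *
    bogKappa n ℓ (volume.real Ω / volume.real (Metric.ball c r)) * √(∫ x, f x ^ 2)
  have M_nonneg : 0 ≤ M := by
    have A_nonneg := hθ.nonneg
    have κ_nonneg := zero_le_one.trans
      (one_le_bogKappa (n := n) (ℓ := ℓ) (one_le_volume_real_div_volume_real_ball hΩb hr hB))
    positivity
  obtain ⟨g, hg, g_le⟩ := exists_hasL2WeakGradient_univ
    (memLp_bogReduced θ_continuous hθ.hasCompactSupport hΩ hΩb.measure_lt_top.ne f_integrable hf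
      hfΩ coord_le) M_nonneg
    fun j φ hφ hφc => weak_bound m j hΩ hΩb hr hB hθ hf hfΩ hφ hφc
  refine ⟨g, hg, g_le.trans ?_⟩
  calc √n * M ≤ (√n + 1) * M := by gcongr; simp
    _ = _ := by ring

theorem mainTheorem8 (n ℓ : ℕ) (hℓ : 1 ≤ ℓ) (hℓn : ℓ ≤ n) (K : (Fin n → ℕ) → ℝ) :
    ∃ C : ℝ, 0 < C ∧
      ∀ (Ω : Set (EuclideanSpace ℝ (Fin n))) (c : EuclideanSpace ℝ (Fin n)) (r : ℝ),
        IsBoundedDomainStarShapedBall Ω c r →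
      ∀ θ : EuclideanSpace ℝ (Fin n) → ℝ, IsRegularizingKernel K c r θ →
      ∀ (m : Fin n) (f : EuclideanSpace ℝ (Fin n) → ℝ),
        MemLp f 2 volume → (∀ᵐ x ∂volume, x ∉ closure Ω → f x = 0) →
        (∀ᵐ x ∂volume.restrict Ω, Integrable
          (fun p : ℝ × EuclideanSpace ℝ (Fin n) => bogIntegrand ℓ θ m f x p.1 p.2)
          ((volume.restrict (Ioo (0 : ℝ) 1)).prod volume)) ∧
        ∃ g : Fin n → EuclideanSpace ℝ (Fin n) → ℝ,
          HasL2WeakGradient Ω (bogReduced ℓ θ m f) g ∧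
          Real.sqrt (∑ j, ∫ x in Ω, g j x ^ 2) ≤
            C * (Metric.diam Ω / Metric.diam (Metric.ball c r)) *
              bogKappa n ℓ (volume.real Ω / volume.real (Metric.ball c r)) *
              Real.sqrt (∫ x in Ω, f x ^ 2) := by
  obtain ⟨C, C_pos, gradient_bound⟩ := mainTheorem8_general n ℓ hℓn
  refine ⟨C * kernelConstant K, mul_pos C_pos (kernelConstant_pos K),
    fun Ω c r hΩ θ hθ m f hf hf_closure => ?_⟩
  have : Nonempty (Fin n) := ⟨m⟩
  have hfΩ := hΩ.ae_eq_zero_of_notMem hf_closure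
  obtain ⟨integrable_ae, g, hg, g_le⟩ := gradient_bound _ Ω c r hΩ.isOpen.measurableSet
    hΩ.isBounded hΩ.radius_pos hΩ.ball_subset θ (hθ.isBump hΩ.radius_pos.le) m f hf hfΩ
  have sq_eq_zero : ∀ᵐ x, x ∉ Ω → f x ^ 2 = 0 := by
    filter_upwards [hfΩ] with x hx hxΩ
    rw [hx hxΩ, zero_pow two_ne_zero]
  refine ⟨ae_restrict_of_ae integrable_ae, g, hg.mono .univ (subset_univ Ω),
    (hg.sqrt_sum_setIntegral_sq_le Ω).trans ?_⟩
  rwa [setIntegral_eq_integral_of_ae_compl_eq_zero sq_eq_zero]
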